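/- **Setting.** Let $A$ be an irreducible $k\times k$ matrix with non-negative integer entries. Take the directed graph with states $1,\dots,k$ and $A_{IJ}$ edges from $I$ to $J$. Let $X_A$ be the space of bi-infinite sequences $x=(x_i)_{i\in\mathbb Z}$ of edges such that $x_{i+1}$ starts at the state where $x_i$ ends, with the topology induced by the product topology over the discrete edge set, and let $\sigma_A$ be the shift, $(\sigma_A x)_i=x_{i+1}$. Assume that $(X_A,\sigma_A)$ has positive topological entropy. Let $\mathrm{Aut}(\sigma_A)$ be the group of homeomorphisms of $X_A$ commuting with $\sigma_A$. **Dimension triple.** Matrices act on row vectors. Put $R(A)=\mathbb Q^kA^k$, $\mathcal G_A=\{x\in R(A): xA^m\in\mathbb Z^k\text{ for some }m\ge 0\}$, $\mathcal G_A^+=\{x\in R(A): xA^m\in(\mathbb Z_{\ge0})^k\text{ for some }m\ge 0\}$ and $\delta_A(x)=xA$, an automorphism of $\mathcal G_A$. Let $\mathrm{Aut}(\mathcal G_A,\mathcal G_A^+,\delta_A)$ be the group of automorphisms of the group $\mathcal G_A$ that map $\mathcal G_A^+$ onto itself and commute with $\delta_A$. **Dimension representation.** An $m$-ray is a set $\{y\in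 X_A: y_i=x_i\text{ for all }i\le m\}$ with $x\in X_A$; an $m$-beam is a finite union of $m$-rays, and a beam is an $m$-beam for some $m\in\mathbb Z$. For an $m$-beam $U$ let $v_{U,m}\in\mathbb Z^k$ be the vector whose $J$-th entry is the number of distinct $m$-rays contained in $U$ whose $m$-th edge ends at $J$. Beams $U,V$ are equivalent if both are $m$-beams and $v_{U,m}=v_{V,m}$ for some $m$. The set $D_A^+$ of equivalence classes is an abelian semigroup under $[U]+[V]=[U'\cup V']$, where $U',V'$ are disjoint beams equivalent to $U,V$ respectively; let $D_A$ be its group completion. The map $\theta([U])=\delta_A^{-k-n}(v_{U,n}A^k)$, for an $n$-beam $U$, induces an isomorphism $\theta:D_A\to\mathcal G_A$ with $\theta(D_A^+)=\mathcal G_A^+$. Each $\phi\in\mathrm{Aut}(\sigma_A)$ induces an automorphism $\phi_*$ of $D_A$ by $\phi_*([U])=[\phi(U)]$. The dimension representation is the homomorphism $\pi_A:\mathrm{Aut}(\sigma_A)\to\mathrm{Aut}(\mathcal G_A,\mathcal G_A^+,\delta_A)$, $\pi_A(\phi)=\theta\circ\phi_*\circ\theta^{-1}$. An automorphism $\phi$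 is called inert if $\phi\in\ker\pi_A$. **Corollary 3.4.** Suppose in addition that the polynomial $\det(I-tA)\in\mathbb Q[t]$ is irreducible. If $\phi\in\mathrm{Aut}(\sigma_A)$ has topological entropy $h_{\mathrm{top}}(\phi)=0$, then $\phi$ is inert. -/

import Mathlib

namespace SFT

open Set Topology Filter

variable {k : ℕ} {A : Matrix (Fin k) (Fin k) ℕ}

/-- The edges of the directed graph with vertex set `Fin k` and `A i j` edges from `i` to `j`. -/
def Edge (A : Matrix (Fin k) (Fin k) ℕ) : Type := Σ i j : Fin k, Fin (A i j)

/-- The initial state of an edge. -/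
def Edge.src (e : Edge A) : Fin k := e.1

/-- The terminal state of an edge. -/
def Edge.tgt (e : Edge A) : Fin k := e.2.1

instance : Fintype (Edge A) :=
  @Sigma.instFintype (Fin k) (fun i => Σ j : Fin k, Fin (A i j)) (fun _ => inferInstance) _

/-- The alphabet of edges is discrete. -/
instance : UniformSpace (Edge A) := ⊥

instance : DiscreteUniformity (Edge A) := ⟨rfl⟩

/-- The edge shift `X_A`: bi-infinite walks, with the uniformity induced from the product
`(Edge A)^ℤ` of discrete spaces. -/
abbrev EdgeShift (A : Matrix (Fin k) (Fin k) ℕ) : Type :=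
  {x : ℤ → Edge A // ∀ i, (x i).tgt = (x (i + 1)).src}

/-- The shift map `σ_A`, `(σ_A x)_i = x_{i+1}`. -/
def shift (A : Matrix (Fin k) (Fin k) ℕ) : EdgeShift A ≃ₜ EdgeShift A where
  toFun x := ⟨fun i => x.1 (i + 1), fun i => x.2 (i + 1)⟩
  invFun x := ⟨fun i => x.1 (i - 1), fun i => by
    have h := x.2 (i - 1)
    rwa [show i - 1 + 1 = i + 1 - 1 by ring] at h⟩
  left_inv x := Subtype.ext (funext fun i => by simp)
  right_inv x := Subtype.ext (funext fun i => by simp)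
  continuous_toFun := by
    refine Continuous.subtype_mk ?_ _
    exact continuous_pi fun i => (continuous_apply (i + 1)).comp continuous_subtype_val
  continuous_invFun := by
    refine Continuous.subtype_mk ?_ _
    exact continuous_pi fun i => (continuous_apply (i - 1)).comp continuous_subtype_val

/-- `Aut(σ_A)`: the group (under composition) of homeomorphisms of `X_A` commuting with `σ_A`. -/
abbrev AutShift (A : Matrix (Fin k) (Fin k) ℕ) : Subgroup (EdgeShift A ≃ₜ EdgeShift A) :=
  Subgroup.centralizer {shift A}

/-- Topological entropy of a self-map of a compact space (Bowen's definition through the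
uniformity). -/
noncomputable def topEntropy {X : Type*} [UniformSpace X] (f : X → X) : EReal :=
  Dynamics.coverEntropy f univ

/-- The `m`-ray `R(x, m)`. -/
def ray (x : EdgeShift A) (m : ℤ) : Set (EdgeShift A) := {y | ∀ i ≤ m, y.1 i = x.1 i}

/-- An `m`-beam is a finite union of `m`-rays. -/
def IsBeam (U : Set (EdgeShift A)) (m : ℤ) : Prop :=
  ∃ s : Set (EdgeShift A), s.Finite ∧ U = ⋃ x ∈ s, ray x m

/-- The `m`-rays contained in the `m`-beam `U` whose last edge ends at the state `J`. -/
def endRays (U : Set (EdgeShift A)) (m : ℤ) (J : Fin k) : Set (Set (EdgeShift A)) :=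
  {R | ∃ x ∈ U, (x.1 m).tgt = J ∧ ray x m = R}

/-- The vector `v_{U,m}`: its `J`-th entry is the number of (distinct) `m`-rays of `U` that end
at `J`. -/
noncomputable def endCount (U : Set (EdgeShift A)) (m : ℤ) (J : Fin k) : ℕ :=
  (endRays U m J).ncard

lemma ray_eq_iff {x y : EdgeShift A} {m : ℤ} : ray x m = ray y m ↔ ∀ i ≤ m, x.1 i = y.1 i := by
  constructor
  · intro h
    have : x ∈ ray x m := fun i _ => rfl
    rw [h] at this
    exact this
  · intro h
    ext z
    exact ⟨fun hz i hi => (hz i hi).trans (h i hi), fun hz i hi => (hz i hi).trans (h i hi).symm⟩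

lemma exists_finite_reps {α β : Type*} {f : α → β} {U : Set α} (h : (f '' U).Finite) :
    ∃ t ⊆ U, t.Finite ∧ f '' t = f '' U := by
  rcases U.eq_empty_or_nonempty with rfl | ⟨u, -⟩
  · exact ⟨∅, subset_rfl, Set.finite_empty, rfl⟩
  have : Nonempty α := ⟨u⟩
  have key : ∀ b ∈ f '' U, ∃ a ∈ U, f a = b := fun b hb => hb
  choose! g hgU hg using key
  refine ⟨g '' (f '' U), ?_, h.image g, ?_⟩
  · rintro _ ⟨b, hb, rfl⟩; exact hgU b hb
  · ext b
    constructor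
    · rintro ⟨_, ⟨b', hb', rfl⟩, rfl⟩; rw [hg b' hb']; exact hb'
    · intro hb; exact ⟨g b, ⟨b, hb, rfl⟩, hg b hb⟩

lemma isBeam_iff {U : Set (EdgeShift A)} {m : ℤ} :
    IsBeam U m ↔ (∀ x ∈ U, ray x m ⊆ U) ∧ ((fun x => ray x m) '' U).Finite := by
  constructor
  · rintro ⟨s, hs, rfl⟩
    constructor
    · intro x hx y hy
      simp only [mem_iUnion] at hx ⊢
      obtain ⟨z, hz, hxz⟩ := hx
      exact ⟨z, hz, fun i hi => (hy i hi).trans (hxz i hi)⟩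
    · refine (hs.image (fun x => ray x m)).subset ?_
      rintro _ ⟨x, hx, rfl⟩
      simp only [mem_iUnion] at hx
      obtain ⟨z, hz, hxz⟩ := hx
      exact ⟨z, hz, ray_eq_iff.2 fun i hi => (hxz i hi).symm⟩
  · rintro ⟨h1, h2⟩
    obtain ⟨t, htU, ht, hte⟩ := exists_finite_reps h2
    refine ⟨t, ht, ?_⟩
    ext y
    simp only [mem_iUnion]
    constructor
    · intro hy
      have : ray y m ∈ (fun x => ray x m) '' t := by rw [hte]; exact ⟨y, hy, rfl⟩
      obtain ⟨x, hx, hxy⟩ := this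
      exact ⟨x, hx, ray_eq_iff.1 hxy.symm⟩
    · rintro ⟨x, hx, hxy⟩
      exact h1 x (htU hx) hxy

lemma endRays_finite {U : Set (EdgeShift A)} {m : ℤ} (h : IsBeam U m) (J : Fin k) :
    (endRays U m J).Finite :=
  (isBeam_iff.1 h).2.subset (by rintro _ ⟨x, hx, -, rfl⟩; exact ⟨x, hx, rfl⟩)

lemma IsBeam.succ {U : Set (EdgeShift A)} {m : ℤ} (h : IsBeam U m) : IsBeam U (m + 1) := by
  rw [isBeam_iff] at h ⊢
  refine ⟨fun x hx y hy => h.1 x hx fun i hi => hy i (by omega), ?_⟩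
  have hf : ((((fun x => ray x m) '' U) ×ˢ (univ : Set (Edge A)))).Finite :=
    h.2.prod (Set.toFinite _)
  have h3 : ((fun x : EdgeShift A => (ray x m, x.1 (m + 1))) '' U).Finite :=
    hf.subset (by rintro _ ⟨x, hx, rfl⟩; exact ⟨⟨x, hx, rfl⟩, trivial⟩)
  obtain ⟨t, htU, ht, hte⟩ := exists_finite_reps h3
  refine (ht.image (fun x => ray x (m + 1))).subset ?_
  rintro _ ⟨x, hx, rfl⟩
  have : (ray x m, x.1 (m + 1)) ∈ (fun x : EdgeShift A => (ray x m, x.1 (m + 1))) '' t := by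
    rw [hte]; exact ⟨x, hx, rfl⟩
  obtain ⟨y, hy, hxy⟩ := this
  simp only [Prod.mk.injEq] at hxy
  refine ⟨y, hy, ray_eq_iff.2 fun i hi => ?_⟩
  rcases eq_or_lt_of_le hi with rfl | hi
  · exact hxy.2
  · exact ray_eq_iff.1 hxy.1 i (by omega)

lemma IsBeam.mono {U : Set (EdgeShift A)} {m n : ℤ} (h : IsBeam U m) (hmn : m ≤ n) :
    IsBeam U n := by
  obtain ⟨d, rfl⟩ := Int.le.dest hmn
  induction d with
  | zero => simpa using h
  | succ d ih =>
    have := (ih (by omega)).succ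
    rwa [show m + d + 1 = m + ((d + 1 : ℕ) : ℤ) by push_cast; ring] at this

lemma IsBeam.union {U V : Set (EdgeShift A)} {m : ℤ} (hU : IsBeam U m) (hV : IsBeam V m) :
    IsBeam (U ∪ V) m := by
  obtain ⟨s, hs, rfl⟩ := hU
  obtain ⟨t, ht, rfl⟩ := hV
  exact ⟨s ∪ t, hs.union ht, by rw [biUnion_union]⟩

lemma endCount_union {U V : Set (EdgeShift A)} {m : ℤ} (hU : IsBeam U m) (hV : IsBeam V m)
    (hUV : Disjoint U V) (J : Fin k) :
    endCount (U ∪ V) m J = endCount U m J + endCount V m J := by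
  unfold endCount
  rw [← Set.ncard_union_eq _ (endRays_finite hU J) (endRays_finite hV J)]
  · congr 1
    ext R
    constructor
    · rintro ⟨x, hx | hx, h⟩
      · exact Or.inl ⟨x, hx, h⟩
      · exact Or.inr ⟨x, hx, h⟩
    · rintro (⟨x, hx, h⟩ | ⟨x, hx, h⟩)
      · exact ⟨x, Or.inl hx, h⟩
      · exact ⟨x, Or.inr hx, h⟩
  · rw [Set.disjoint_left]
    rintro R ⟨x, hx, -, rfl⟩ ⟨y, hy, -, hyR⟩
    refine Set.disjoint_left.1 hUV hx ((isBeam_iff.1 hV).1 y hy ?_)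
    exact ray_eq_iff.1 hyR.symm

/-- Follow `x` up to time `m` and `y` afterwards. -/
def splice (x y : EdgeShift A) (m : ℤ) (h : (x.1 m).tgt = (y.1 m).tgt) : EdgeShift A :=
  ⟨fun i => if i ≤ m then x.1 i else y.1 i, fun i => by
    beta_reduce
    rcases lt_trichotomy i m with hi | rfl | hi
    · rw [if_pos (by omega), if_pos (by omega)]; exact x.2 i
    · rw [if_pos le_rfl, if_neg (by omega), h]; exact y.2 i
    · rw [if_neg (by omega), if_neg (by omega)]; exact y.2 i⟩

lemma splice_le {x y : EdgeShift A} {m : ℤ} (h : (x.1 m).tgt = (y.1 m).tgt) {i : ℤ} (hi : i ≤ m) :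
    (splice x y m h).1 i = x.1 i := if_pos hi

lemma splice_gt {x y : EdgeShift A} {m : ℤ} (h : (x.1 m).tgt = (y.1 m).tgt) {i : ℤ} (hi : m < i) :
    (splice x y m h).1 i = y.1 i := if_neg (by omega)

lemma endCount_le_of_rel {U V : Set (EdgeShift A)} {n n' : ℤ} {J : Fin k} (hV : IsBeam V n')
    (r : EdgeShift A → EdgeShift A → Prop) (hr : ∀ y ∈ U, ∃ z ∈ V, r y z)
    (h1 : ∀ y ∈ U, ∀ z ∈ V, r y z → (y.1 n).tgt = (z.1 n').tgt)
    (h2 : ∀ y ∈ U, ∀ y' ∈ U, ∀ z ∈ V, ∀ z' ∈ V, r y z → r y' z' →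
      ray z n' = ray z' n' → ray y n = ray y' n) :
    endCount U n J ≤ endCount V n' J := by
  choose! f hfV hf using hr
  have key : ∀ R ∈ endRays U n J, ∃ x ∈ U, (x.1 n).tgt = J ∧ ray x n = R := fun R hR => hR
  have hne : endRays U n J = ∅ ∨ Nonempty (EdgeShift A) := by
    rcases (endRays U n J).eq_empty_or_nonempty with h | ⟨_, x, _⟩
    · exact Or.inl h
    · exact Or.inr ⟨x⟩
  rcases hne with hne | hne
  · simp [endCount, hne]
  choose! g hgU hgJ hg using key
  refine Set.ncard_le_ncard_of_injOn (fun R => ray (f (g R)) n') ?_ ?_ (endRays_finite hV J)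
  · intro R hR
    exact ⟨f (g R), hfV _ (hgU R hR),
      (h1 _ (hgU R hR) _ (hfV _ (hgU R hR)) (hf _ (hgU R hR))).symm.trans (hgJ R hR), rfl⟩
  · intro R hR R' hR' h
    rw [← hg R hR, ← hg R' hR']
    exact h2 _ (hgU R hR) _ (hgU R' hR') _ (hfV _ (hgU R hR)) _ (hfV _ (hgU R' hR'))
      (hf _ (hgU R hR)) (hf _ (hgU R' hR')) h

lemma endCount_eq_of_rel {U V : Set (EdgeShift A)} {n n' : ℤ} {J : Fin k} (hU : IsBeam U n)
    (hV : IsBeam V n') (r : EdgeShift A → EdgeShift A → Prop) (hr : ∀ y ∈ U, ∃ z ∈ V, r y z)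
    (hr' : ∀ z ∈ V, ∃ y ∈ U, r y z)
    (h1 : ∀ y ∈ U, ∀ z ∈ V, r y z → (y.1 n).tgt = (z.1 n').tgt)
    (h2 : ∀ y ∈ U, ∀ y' ∈ U, ∀ z ∈ V, ∀ z' ∈ V, r y z → r y' z' →
      (ray y n = ray y' n ↔ ray z n' = ray z' n')) :
    endCount U n J = endCount V n' J := by
  apply le_antisymm
  · exact endCount_le_of_rel hV r hr h1
      fun y hy y' hy' z hz z' hz' a b => (h2 y hy y' hy' z hz z' hz' a b).2
  · exact endCount_le_of_rel hU (fun z y => r y z) hr' (fun z hz y hy a => (h1 y hy z hz a).symm)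
      fun z hz z' hz' y hy y' hy' a b => (h2 y hy y' hy' z hz z' hz' a b).1

instance : CompactSpace (EdgeShift A) := by
  refine isCompact_iff_compactSpace.mp (?_ : IsCompact {x : ℤ → Edge A | ∀ i, (x i).tgt = (x (i + 1)).src})
  apply IsClosed.isCompact
  rw [show {x : ℤ → Edge A | ∀ i, (x i).tgt = (x (i + 1)).src} =
    ⋂ i, {x : ℤ → Edge A | (x i).tgt = (x (i + 1)).src} by ext; simp]
  refine isClosed_iInter fun i => isClosed_eq ?_ ?_
  · exact (continuous_of_discreteTopology (f := Edge.tgt (A := A))).comp (continuous_apply i)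
  · exact (continuous_of_discreteTopology (f := Edge.src (A := A))).comp (continuous_apply (i + 1))

lemma exists_window (f : EdgeShift A → EdgeShift A) (hf : Continuous f) :
    ∃ N : ℕ, ∀ x y : EdgeShift A, (∀ i : ℤ, -N ≤ i → i ≤ N → x.1 i = y.1 i) →
      (f x).1 0 = (f y).1 0 := by
  have hg : Continuous fun x => (f x).1 0 := (continuous_apply 0).comp
    (continuous_subtype_val.comp hf)
  have hcyl : ∀ (x : EdgeShift A) (N : ℕ),
      IsOpen {y : EdgeShift A | ∀ i ∈ Set.Icc (-N : ℤ) N, y.1 i = x.1 i} := by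
    intro x N
    have : {y : EdgeShift A | ∀ i ∈ Set.Icc (-N : ℤ) N, y.1 i = x.1 i} =
        ⋂ i ∈ Set.Icc (-N : ℤ) N, (fun y : EdgeShift A => y.1 i) ⁻¹' {x.1 i} := by
      ext y; simp
    rw [this]
    refine (Set.finite_Icc _ _).isOpen_biInter fun i _ => ?_
    exact (isOpen_discrete _).preimage ((continuous_apply i).comp continuous_subtype_val)
  have hloc : ∀ x : EdgeShift A, ∃ N : ℕ, ∀ y : EdgeShift A,
      (∀ i ∈ Set.Icc (-N : ℤ) N, y.1 i = x.1 i) → (f y).1 0 = (f x).1 0 := by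
    intro x
    have ho : IsOpen ((fun x => (f x).1 0) ⁻¹' {(f x).1 0}) := (isOpen_discrete _).preimage hg
    obtain ⟨W, hW, hWe⟩ := isOpen_induced_iff.1 ho
    have hxW : x.1 ∈ W := by
      have : x ∈ Subtype.val ⁻¹' W := by rw [hWe]; rfl
      exact this
    obtain ⟨I, u, hu, huW⟩ := isOpen_pi_iff.1 hW x.1 hxW
    refine ⟨I.sup Int.natAbs, fun y hy => ?_⟩
    have : y ∈ Subtype.val ⁻¹' W := by
      refine huW fun i hi => ?_
      have hle : i.natAbs ≤ I.sup Int.natAbs := Finset.le_sup (f := Int.natAbs) hi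
      rw [hy i ⟨by omega, by omega⟩]
      exact (hu i hi).2
    rw [hWe] at this
    exact this
  choose N hN using hloc
  obtain ⟨t, ht⟩ := isCompact_univ.elim_finite_subcover
    (fun x : EdgeShift A => {y : EdgeShift A | ∀ i ∈ Set.Icc (-(N x : ℤ)) (N x), y.1 i = x.1 i})
    (fun x => hcyl x (N x)) (fun x _ => mem_iUnion.2 ⟨x, fun i _ => rfl⟩)
  refine ⟨t.sup N, fun x y hxy => ?_⟩
  have hx := ht (mem_univ x)
  simp only [mem_iUnion] at hx
  obtain ⟨z, hz, hxz⟩ := hx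
  have hle : N z ≤ t.sup N := Finset.le_sup hz
  rw [hN z x hxz, hN z y]
  intro i hi
  rw [← hxz i hi, hxy i (by have := hi.1; omega) (by have := hi.2; omega)]

lemma shift_zpow_apply (n : ℤ) (x : EdgeShift A) (i : ℤ) :
    ((shift A ^ n) x).1 i = x.1 (i + n) := by
  induction n generalizing x i with
  | zero => simp
  | succ n ih =>
    rw [zpow_add_one, Homeomorph.mul_apply, ih]
    change x.1 (i + n + 1) = _
    rw [add_assoc]
  | pred n ih =>
    rw [zpow_sub_one, Homeomorph.mul_apply, ih]
    change x.1 (i + -n - 1) = _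
    rw [add_sub_assoc]

lemma AutShift.exists_window (φ : AutShift A) : ∃ N : ℕ, ∀ (x y : EdgeShift A) (m : ℤ),
    (∀ i : ℤ, m - N ≤ i → i ≤ m + N → x.1 i = y.1 i) → (φ.1 x).1 m = (φ.1 y).1 m := by
  obtain ⟨N, hN⟩ := SFT.exists_window φ.1 φ.1.continuous
  have hc : ∀ (n : ℤ), (shift A ^ n) * φ.1 = φ.1 * (shift A ^ n) := by
    intro n
    have := Subgroup.mem_centralizer_singleton_iff.1 φ.2
    exact ((show Commute φ.1 (shift A) from this).zpow_right n).symm.eq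
  have hc' : ∀ n x, (φ.1 x).1 n = (φ.1 ((shift A ^ n) x)).1 0 := by
    intro n x
    rw [← Homeomorph.mul_apply, ← hc, Homeomorph.mul_apply, shift_zpow_apply, zero_add]
  refine ⟨N, fun x y m h => ?_⟩
  rw [hc', hc' m y]
  refine hN _ _ fun i h1 h2 => ?_
  rw [shift_zpow_apply, shift_zpow_apply]
  exact h _ (by omega) (by omega)

/-- A common coding range of `φ` and `φ⁻¹`. -/
lemma AutShift.exists_window₂ (φ : AutShift A) : ∃ N : ℕ, (∀ (x y : EdgeShift A) (m : ℤ),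
    (∀ i : ℤ, m - N ≤ i → i ≤ m + N → x.1 i = y.1 i) → (φ.1 x).1 m = (φ.1 y).1 m) ∧
    (∀ (x y : EdgeShift A) (m : ℤ),
    (∀ i : ℤ, m - N ≤ i → i ≤ m + N → (φ.1 x).1 i = (φ.1 y).1 i) → x.1 m = y.1 m) := by
  obtain ⟨N, hN⟩ := AutShift.exists_window φ
  obtain ⟨M, hM⟩ := AutShift.exists_window φ⁻¹
  refine ⟨max N M, fun x y m h => hN x y m fun i h1 h2 => h i (by omega) (by omega),
    fun x y m h => ?_⟩
  have := hM (φ.1 x) (φ.1 y) m fun i h1 h2 => h i (by omega) (by omega)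
  simpa using this

lemma IsBeam.image_aut (φ : AutShift A) {N : ℕ}
    (hN : ∀ (x y : EdgeShift A) (m : ℤ),
    (∀ i : ℤ, m - N ≤ i → i ≤ m + N → x.1 i = y.1 i) → (φ.1 x).1 m = (φ.1 y).1 m)
    (hN' : ∀ (x y : EdgeShift A) (m : ℤ),
    (∀ i : ℤ, m - N ≤ i → i ≤ m + N → (φ.1 x).1 i = (φ.1 y).1 i) → x.1 m = y.1 m)
    {U : Set (EdgeShift A)} {m : ℤ} (hU : IsBeam U m) : IsBeam (φ.1 '' U) (m + N) := by
  rw [isBeam_iff]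
  constructor
  · rintro _ ⟨x, hx, rfl⟩ z hz
    obtain ⟨y, rfl⟩ := φ.1.surjective z
    refine ⟨y, (isBeam_iff.1 hU).1 x hx fun i hi => ?_, rfl⟩
    exact hN' _ _ _ fun j _ h2 => hz j (by omega)
  · have h := (isBeam_iff.1 (hU.mono (show m ≤ m + N + N by omega))).2
    obtain ⟨t, htU, ht, hte⟩ := exists_finite_reps h
    refine (ht.image (fun x => ray (φ.1 x) (m + N))).subset ?_
    rintro _ ⟨_, ⟨x, hx, rfl⟩, rfl⟩
    have : ray x (m + N + N) ∈ (fun x => ray x (m + N + N)) '' t := by rw [hte]; exact ⟨x, hx, rfl⟩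
    obtain ⟨y, hy, hxy⟩ := this
    refine ⟨y, hy, ray_eq_iff.2 fun i hi => hN _ _ _ fun j _ h2 => ?_⟩
    exact ray_eq_iff.1 hxy j (by omega)

lemma endCount_image_aut (φ : AutShift A) {N : ℕ}
    (hN : ∀ (x y : EdgeShift A) (m : ℤ),
    (∀ i : ℤ, m - N ≤ i → i ≤ m + N → x.1 i = y.1 i) → (φ.1 x).1 m = (φ.1 y).1 m)
    (hN' : ∀ (x y : EdgeShift A) (m : ℤ),
    (∀ i : ℤ, m - N ≤ i → i ≤ m + N → (φ.1 x).1 i = (φ.1 y).1 i) → x.1 m = y.1 m)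
    {U V : Set (EdgeShift A)} {m : ℤ} (hU : IsBeam U m) (hV : IsBeam V m)
    (h : endCount U m = endCount V m) :
    endCount (φ.1 '' U) (m + N + N + N + 1) = endCount (φ.1 '' V) (m + N + N + N + 1) := by
  have hb : ∀ J, Nonempty (endRays U m J ≃ endRays V m J) := fun J => by
    have := (endRays_finite hU J).to_subtype
    have := (endRays_finite hV J).to_subtype
    have h' := congrFun h J
    unfold endCount at h'
    exact Finite.card_eq.1 (by simpa only [Nat.card_coe_set_eq] using h')
  have e : ∀ J, endRays U m J ≃ endRays V m J := fun J => (hb J).some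
  -- matching points of `U` and `V`
  let r : EdgeShift A → EdgeShift A → Prop := fun y z =>
    (∃ J, ∃ hy : ray y m ∈ endRays U m J, (e J ⟨ray y m, hy⟩).1 = ray z m) ∧
      ∀ i, m < i → y.1 i = z.1 i
  have hmem : ∀ {W : Set (EdgeShift A)} {y : EdgeShift A} {J},
      ray y m ∈ endRays W m J → (y.1 m).tgt = J := by
    rintro W y J ⟨x, _, hx, hxy⟩
    rw [← hx, ray_eq_iff.1 hxy m le_rfl]
  have hr : ∀ y ∈ U, ∃ z ∈ V, r y z := by
    intro y hy
    have hyR : ray y m ∈ endRays U m (y.1 m).tgt := ⟨y, hy, rfl, rfl⟩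
    obtain ⟨x, hx, hxJ, hxR⟩ := (e _ ⟨_, hyR⟩).2
    have hsp : ray (splice x y m hxJ) m = ray x m := ray_eq_iff.2 fun i hi => splice_le hxJ hi
    refine ⟨splice x y m hxJ, (isBeam_iff.1 hV).1 x hx fun i hi => splice_le hxJ hi,
      ⟨_, hyR, ?_⟩, fun i hi => (splice_gt hxJ hi).symm⟩
    rw [hsp, hxR]
  have hr' : ∀ z ∈ V, ∃ y ∈ U, r y z := by
    intro z hz
    have hzR : ray z m ∈ endRays V m (z.1 m).tgt := ⟨z, hz, rfl, rfl⟩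
    obtain ⟨x, hx, hxJ, hxR⟩ := ((e _).symm ⟨_, hzR⟩).2
    have hsp : ray (splice x z m hxJ) m = ray x m := ray_eq_iff.2 fun i hi => splice_le hxJ hi
    refine ⟨splice x z m hxJ, (isBeam_iff.1 hU).1 x hx fun i hi => splice_le hxJ hi,
      ⟨(z.1 m).tgt, ?_, ?_⟩, fun i hi => (splice_gt hxJ hi)⟩
    · rw [hsp]; exact ⟨x, hx, hxJ, rfl⟩
    · simp only [hsp, hxR, Subtype.coe_eta, Equiv.apply_symm_apply]
  have hpast : ∀ y z y' z', r y z → r y' z' → (ray y m = ray y' m ↔ ray z m = ray z' m) := by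
    rintro y z y' z' ⟨⟨J, h1, h2⟩, -⟩ ⟨⟨J', h1', h2'⟩, -⟩
    rw [← h2, ← h2']
    constructor
    · intro hyy
      obtain rfl : J = J' := by rw [← hmem h1, ← hmem h1', ray_eq_iff.1 hyy m le_rfl]
      simp only [hyy]
    · intro hzz
      have hz : ray z m ∈ endRays V m J := h2 ▸ (e J ⟨_, h1⟩).2
      have hz' : ray z' m ∈ endRays V m J' := h2' ▸ (e J' ⟨_, h1'⟩).2
      have hzz' : ray z m = ray z' m := by rw [← h2, ← h2', hzz]
      obtain rfl : J = J' := by rw [← hmem hz, ← hmem hz', ray_eq_iff.1 hzz' m le_rfl]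
      exact congrArg Subtype.val ((e J).injective (Subtype.ext hzz))
  have hagree : ∀ n, m ≤ n → ∀ y z y' z', r y z → r y' z' →
      (ray y n = ray y' n ↔ ray z n = ray z' n) := by
    intro n hn y z y' z' h1 h2
    have hp := hpast y z y' z' h1 h2
    simp only [ray_eq_iff] at hp ⊢
    constructor
    · intro h3 i hi
      by_cases him : i ≤ m
      · exact hp.1 (fun j hj => h3 j (by omega)) i him
      · rw [← h1.2 i (by omega), ← h2.2 i (by omega), h3 i hi]
    · intro h3 i hi
      by_cases him : i ≤ m
      · exact hp.2 (fun j hj => h3 j (by omega)) i him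
      · rw [h1.2 i (by omega), h2.2 i (by omega), h3 i hi]
  have htail : ∀ y z, r y z → ∀ i, m + N < i → (φ.1 y).1 i = (φ.1 z).1 i :=
    fun y z hyz i hi => hN _ _ _ fun j h1 _ => hyz.2 j (by omega)
  have hdown : ∀ y y' n, ray (φ.1 y) (n + N) = ray (φ.1 y') (n + N) → ray y n = ray y' n := by
    intro y y' n hyy
    refine ray_eq_iff.2 fun i hi => hN' _ _ _ fun j _ hj => ray_eq_iff.1 hyy j (by omega)
  have hup : ∀ y y' n, ray y (n + N) = ray y' (n + N) → ray (φ.1 y) n = ray (φ.1 y') n := by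
    intro y y' n hyy
    refine ray_eq_iff.2 fun i hi => hN _ _ _ fun j _ hj => ray_eq_iff.1 hyy j (by omega)
  funext J
  refine endCount_eq_of_rel ((hU.image_aut φ hN hN').mono (by omega))
    ((hV.image_aut φ hN hN').mono (by omega))
    (fun y z => ∃ y₀ z₀, φ.1 y₀ = y ∧ φ.1 z₀ = z ∧ r y₀ z₀) ?_ ?_ ?_ ?_
  · rintro _ ⟨y, hy, rfl⟩
    obtain ⟨z, hz, hyz⟩ := hr y hy
    exact ⟨_, ⟨z, hz, rfl⟩, y, z, rfl, rfl, hyz⟩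
  · rintro _ ⟨z, hz, rfl⟩
    obtain ⟨y, hy, hyz⟩ := hr' z hz
    exact ⟨_, ⟨y, hy, rfl⟩, y, z, rfl, rfl, hyz⟩
  · rintro _ - _ - ⟨y, z, rfl, rfl, hyz⟩
    rw [htail y z hyz _ (by omega)]
  · rintro _ - _ - _ - _ - ⟨y, z, rfl, rfl, hyz⟩ ⟨y', z', rfl, rfl, hyz'⟩
    have e1 : m + N + N + N + 1 = m + N + N + 1 + N := by ring
    have e2 : m + N + N + 1 = m + N + 1 + N := by ring
    constructor
    · intro h3
      have h4 : ray (φ.1 z) (m + N + 1) = ray (φ.1 z') (m + N + 1) := by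
        apply hup
        rw [← e2, ← hagree _ (by omega) y z y' z' hyz hyz']
        apply hdown
        rw [← e1]; exact h3
      refine ray_eq_iff.2 fun i hi => ?_
      by_cases him : i ≤ m + N
      · exact ray_eq_iff.1 h4 i (by omega)
      · rw [← htail y z hyz i (by omega), ← htail y' z' hyz' i (by omega), ray_eq_iff.1 h3 i hi]
    · intro h3
      have h4 : ray (φ.1 y) (m + N + 1) = ray (φ.1 y') (m + N + 1) := by
        apply hup
        rw [← e2, hagree _ (by omega) y z y' z' hyz hyz']
        apply hdown
        rw [← e1]; exact h3
      refine ray_eq_iff.2 fun i hi => ?_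
      by_cases him : i ≤ m + N
      · exact ray_eq_iff.1 h4 i (by omega)
      · rw [htail y z hyz i (by omega), htail y' z' hyz' i (by omega), ray_eq_iff.1 h3 i hi]

/-- The standing assumptions: `A` is irreducible and `(X_A, σ_A)` has positive entropy. -/
structure PosIrreducible (A : Matrix (Fin k) (Fin k) ℕ) : Prop where
  irreducible : (A.map (Nat.cast : ℕ → ℤ)).IsIrreducible
  entropy_pos : 0 < topEntropy (shift A)

lemma PosIrreducible.exists_pow_pos (h : PosIrreducible A) (i j : Fin k) :
    ∃ t > 0, 0 < (A ^ t) i j := by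
  obtain ⟨t, ht, hp⟩ := (Matrix.isIrreducible_iff_exists_pow_pos
    (fun i j => by simp)).1 h.irreducible i j
  refine ⟨t, ht, ?_⟩
  have e : (A.map (Nat.cast : ℕ → ℤ)) ^ t = (A ^ t).map (Nat.cast : ℕ → ℤ) :=
    (map_pow (Nat.castRingHom ℤ).mapMatrix A t).symm
  rw [e] at hp
  simpa using hp

lemma exists_edge {i j : Fin k} (h : 0 < A i j) : ∃ e : Edge A, e.src = i ∧ e.tgt = j :=
  ⟨⟨i, j, ⟨0, h⟩⟩, rfl, rfl⟩

lemma PosIrreducible.exists_next (h : PosIrreducible A) (i : Fin k) :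
    ∃ e : Edge A, e.src = i := by
  obtain ⟨t, ht, hp⟩ := h.exists_pow_pos i i
  obtain ⟨s, rfl⟩ : ∃ s, t = s + 1 := ⟨t - 1, by omega⟩
  rw [pow_succ', Matrix.mul_apply] at hp
  obtain ⟨l, -, hl⟩ := Finset.exists_ne_zero_of_sum_ne_zero hp.ne'
  obtain ⟨e, he, -⟩ := exists_edge (A := A) (i := i) (j := l)
    (Nat.pos_of_ne_zero (left_ne_zero_of_mul hl))
  exact ⟨e, he⟩

/-- Every walk up to time `m` can be continued by any edge that may follow. -/
lemma PosIrreducible.exists_extension (h : PosIrreducible A) (x : EdgeShift A) (m : ℤ)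
    (e : Edge A) (he : e.src = (x.1 m).tgt) :
    ∃ y : EdgeShift A, y ∈ ray x m ∧ y.1 (m + 1) = e := by
  have hn : ∀ e : Edge A, ∃ e' : Edge A, e'.src = e.tgt := fun e => h.exists_next e.tgt
  choose nx hnx using hn
  refine ⟨⟨fun i => if i ≤ m then x.1 i else nx^[(i - m - 1).toNat] e, fun i => ?_⟩,
    fun i hi => if_pos hi, ?_⟩
  · beta_reduce
    rcases lt_trichotomy i m with hi | rfl | hi
    · rw [if_pos (by omega), if_pos (by omega)]; exact x.2 i
    · rw [if_pos le_rfl, if_neg (by omega), ← he]; simp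
    · rw [if_neg (by omega), if_neg (by omega),
        show (i + 1 - m - 1).toNat = (i - m - 1).toNat + 1 by omega,
        Function.iterate_succ_apply', hnx]
  · change (if m + 1 ≤ m then _ else _) = e
    rw [if_neg (by omega)]
    simp

/-- Sends an `(m+1)`-ray to the `m`-ray containing it. -/
def coarsen (m : ℤ) (R : Set (EdgeShift A)) : Set (EdgeShift A) := ⋃ x ∈ R, ray x m

lemma coarsen_ray (x : EdgeShift A) (m : ℤ) : coarsen m (ray x (m + 1)) = ray x m := by
  ext z
  simp only [coarsen, mem_iUnion]
  constructor
  · rintro ⟨y, hy, hz⟩ i hi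
    rw [hz i hi, hy i (by omega)]
  · exact fun hz => ⟨x, fun _ _ => rfl, hz⟩

lemma PosIrreducible.endCount_succ (h : PosIrreducible A) {U : Set (EdgeShift A)} {m : ℤ}
    (hU : IsBeam U m) : endCount U (m + 1) = Matrix.vecMul (endCount U m) A := by
  classical
  funext J
  let T : Edge A → Set (Set (EdgeShift A)) := fun e =>
    {R | ∃ x ∈ U, x.1 (m + 1) = e ∧ e.tgt = J ∧ ray x (m + 1) = R}
  have hT : endRays U (m + 1) J = ⋃ e, T e := by
    ext R
    simp only [mem_iUnion]
    constructor
    · rintro ⟨x, hx, hJ, hR⟩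
      exact ⟨_, x, hx, rfl, hJ, hR⟩
    · rintro ⟨_, x, hx, rfl, hJ, hR⟩
      exact ⟨x, hx, hJ, hR⟩
  have hsub : ∀ e, T e ⊆ endRays U (m + 1) J := fun e => hT ▸ subset_iUnion T e
  have hfin : ∀ e, (T e).Finite := fun e => (endRays_finite hU.succ J).subset (hsub e)
  have hdisj : Pairwise (Function.onFun Disjoint T) := by
    intro e e' hee
    rw [Function.onFun, Set.disjoint_left]
    rintro R ⟨x, -, hx, -, rfl⟩ ⟨x', -, hx', -, hR⟩
    exact hee (by rw [← hx, ← hx', ray_eq_iff.1 hR (m + 1) le_rfl])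
  have hcard : ∀ e, (T e).ncard = if e.tgt = J then endCount U m e.src else 0 := by
    intro e
    split_ifs with hJ
    · have hinj : Set.InjOn (coarsen m) (T e) := by
        rintro _ ⟨x, hx, hxe, -, rfl⟩ _ ⟨y, hy, hye, -, rfl⟩ hxy
        rw [coarsen_ray, coarsen_ray, ray_eq_iff] at hxy
        refine ray_eq_iff.2 fun i hi => ?_
        rcases eq_or_lt_of_le hi with rfl | hi
        · rw [hxe, hye]
        · exact hxy i (by omega)
      rw [← hinj.ncard_image, endCount]
      congr 1
      ext R
      constructor
      · rintro ⟨_, ⟨x, hx, rfl, -, rfl⟩, rfl⟩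
        exact ⟨x, hx, x.2 m, (coarsen_ray x m).symm⟩
      · rintro ⟨x, hx, hxe, rfl⟩
        obtain ⟨y, hy, hye⟩ := h.exists_extension x m e hxe.symm
        refine ⟨_, ⟨y, (isBeam_iff.1 hU).1 x hx hy, hye, hJ, rfl⟩, ?_⟩
        rw [coarsen_ray]
        exact ray_eq_iff.2 hy
    · have : T e = ∅ := by
        ext R
        simp only [mem_empty_iff_false, iff_false]
        rintro ⟨x, -, -, hJ', -⟩
        exact hJ hJ'
      rw [this, Set.ncard_empty]
  rw [endCount, hT, Set.ncard_iUnion_of_finite hfin hdisj, finsum_eq_sum_of_fintype]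
  simp only [hcard]
  have hs : ∀ F : Edge A → ℕ, ∑ e, F e = ∑ i, ∑ j, ∑ a : Fin (A i j), F ⟨i, j, a⟩ := by
    intro F
    let _ : ∀ i, Fintype (Σ j : Fin k, Fin (A i j)) := fun _ => inferInstance
    refine (Fintype.sum_sigma (α := fun i => Σ j : Fin k, Fin (A i j)) F).trans ?_
    exact Finset.sum_congr rfl fun i _ => Fintype.sum_sigma _
  rw [hs]
  simp only [Matrix.vecMul, dotProduct]
  refine Finset.sum_congr rfl fun i _ => ?_
  rw [Finset.sum_eq_single J]
  · simp [Edge.tgt, Edge.src, mul_comm]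
  · intro j _ hj
    simp [Edge.tgt, hj]
  · simp

lemma PosIrreducible.endCount_add (h : PosIrreducible A) {U : Set (EdgeShift A)} {m : ℤ}
    (hU : IsBeam U m) (t : ℕ) : endCount U (m + t) = Matrix.vecMul (endCount U m) (A ^ t) := by
  induction t with
  | zero => simp
  | succ t ih =>
    rw [pow_succ, ← Matrix.vecMul_vecMul, ← ih, ← h.endCount_succ (hU.mono (by omega))]
    congr 1; push_cast; ring

lemma image_zpow_ray (n : ℤ) (x : EdgeShift A) (m : ℤ) :
    (shift A ^ n : EdgeShift A ≃ₜ EdgeShift A) '' ray x m = ray ((shift A ^ n) x) (m - n) := by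
  ext z
  constructor
  · rintro ⟨y, hy, rfl⟩ i hi
    rw [shift_zpow_apply, shift_zpow_apply, hy _ (by omega)]
  · intro hz
    obtain ⟨y, rfl⟩ := (shift A ^ n).surjective z
    refine ⟨y, fun i hi => ?_, rfl⟩
    have := hz (i - n) (by omega)
    simpa [shift_zpow_apply] using this

lemma topEntropy_nonpos_of_finite {X : Type*} [UniformSpace X] [Finite X] (f : X → X) :
    topEntropy f ≤ 0 := by
  have := Fintype.ofFinite X
  refine iSup₂_le fun V hV => ?_
  have hle : ∀ n : ℕ, ((Dynamics.coverMincard f univ V n : ℕ∞) : ENNReal) ≤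
      ((Fintype.card X + 1 : ℕ) : ENNReal) := by
    intro n
    have hc : Dynamics.IsDynCoverOf f univ V n ((Finset.univ : Finset X) : Set X) := by
      intro x _
      refine ⟨x, by simp, ?_⟩
      exact Dynamics.mem_dynEntourage.2 fun k _ => refl_mem_uniformity hV
    have h1 : Dynamics.coverMincard f univ V n ≤ ((Fintype.card X + 1 : ℕ) : ℕ∞) :=
      hc.coverMincard_le_card.trans (by rw [Finset.card_univ]; exact_mod_cast Nat.le_succ _)
    simpa using (ENat.toENNReal_mono h1)
  have h2 : Dynamics.coverEntropyEntourage f univ V ≤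
      ExpGrowth.expGrowthSup (fun _ => ((Fintype.card X + 1 : ℕ) : ENNReal)) :=
    ExpGrowth.expGrowthSup_monotone hle
  rwa [ExpGrowth.expGrowthSup_const (by simp) (by simp)] at h2

lemma endRays_univ_finite_of_edge (h : PosIrreducible A) {I J : Fin k} (hIJ : 0 < A I J) {m : ℤ}
    (hf : (endRays (A := A) univ (m + 1) J).Finite) : (endRays (A := A) univ m I).Finite := by
  refine (hf.image (coarsen m)).subset ?_
  rintro _ ⟨x, -, hx, rfl⟩
  obtain ⟨e, he, he'⟩ := exists_edge hIJ
  obtain ⟨y, hy, hye⟩ := h.exists_extension x m e (he.trans hx.symm)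
  refine ⟨_, ⟨y, trivial, by rw [hye, he'], rfl⟩, ?_⟩
  rw [coarsen_ray]
  exact ray_eq_iff.2 hy

lemma endRays_univ_finite_shift {J : Fin k} {m : ℤ} (n : ℤ)
    (hf : (endRays (A := A) univ m J).Finite) : (endRays (A := A) univ n J).Finite := by
  refine (hf.image (fun R => (shift A ^ (m - n) : EdgeShift A ≃ₜ EdgeShift A) '' R)).subset ?_
  rintro _ ⟨x, -, hx, rfl⟩
  obtain ⟨y, rfl⟩ := (shift A ^ (m - n)).surjective x
  refine ⟨_, ⟨y, trivial, ?_, rfl⟩, ?_⟩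
  · rw [shift_zpow_apply] at hx
    simpa using hx
  · simp only [image_zpow_ray]
    rw [sub_sub_cancel]

/-- Infinitely many rays end at each state. -/
lemma PosIrreducible.endRays_univ_infinite (h : PosIrreducible A) (m : ℤ) (J : Fin k) :
    (endRays (A := A) univ m J).Infinite := by
  intro hfin
  have hpow : ∀ t : ℕ, ∀ I, 0 < (A ^ t) I J → (endRays (A := A) univ m I).Finite := by
    intro t
    induction t with
    | zero =>
      intro I hI
      by_cases hIJ : I = J
      · exact hIJ ▸ hfin
      · simp [hIJ] at hI
    | succ t ih =>
      intro I hI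
      rw [pow_succ', Matrix.mul_apply] at hI
      obtain ⟨L, -, hL⟩ := Finset.exists_ne_zero_of_sum_ne_zero hI.ne'
      exact endRays_univ_finite_of_edge h (Nat.pos_of_ne_zero (left_ne_zero_of_mul hL))
        (endRays_univ_finite_shift _ (ih L (Nat.pos_of_ne_zero (right_ne_zero_of_mul hL))))
  have hall : ∀ n : ℤ, (range fun x : EdgeShift A => ray x n).Finite := by
    intro n
    refine (Set.finite_iUnion fun I => endRays_univ_finite_shift (A := A) (J := I) (m := m) n ?_).subset
      (t := range fun x : EdgeShift A => ray x n) ?_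
    · obtain ⟨t, -, ht⟩ := h.exists_pow_pos I J
      exact hpow t I ht
    · rintro _ ⟨x, rfl⟩
      exact mem_iUnion.2 ⟨_, x, trivial, rfl, rfl⟩
  have hstep : ∀ (n : ℤ) (x y : EdgeShift A), ray x n = ray y n → ray x (n + 1) = ray y (n + 1) := by
    intro n x y hxy
    have himg : coarsen n '' (range fun x : EdgeShift A => ray x (n + 1)) =
        range fun x : EdgeShift A => ray x n := by
      rw [← range_comp]
      congr 1
      funext x
      exact coarsen_ray x n
    have himg' : (fun R => (shift A ^ (1 : ℤ) : EdgeShift A ≃ₜ EdgeShift A) '' R) ''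
        (range fun x : EdgeShift A => ray x (n + 1)) = range fun x : EdgeShift A => ray x n := by
      ext R
      constructor
      · rintro ⟨_, ⟨x, rfl⟩, rfl⟩
        refine ⟨(shift A ^ (1 : ℤ)) x, ?_⟩
        simp only [image_zpow_ray]
        rw [add_sub_cancel_right]
      · rintro ⟨x, rfl⟩
        obtain ⟨y, rfl⟩ := (shift A ^ (1 : ℤ)).surjective x
        refine ⟨_, ⟨y, rfl⟩, ?_⟩
        simp only [image_zpow_ray]
        rw [add_sub_cancel_right]
    have hinj' : Function.Injective
        (fun R => (shift A ^ (1 : ℤ) : EdgeShift A ≃ₜ EdgeShift A) '' R) :=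
      Set.image_injective.2 (shift A ^ (1 : ℤ)).injective
    have hc : (range fun x : EdgeShift A => ray x n).ncard =
        (range fun x : EdgeShift A => ray x (n + 1)).ncard := by
      conv_lhs => rw [← himg']
      exact Set.ncard_image_of_injective _ hinj'
    have hinj : Set.InjOn (coarsen n) (range fun x : EdgeShift A => ray x (n + 1)) :=
      Set.injOn_of_ncard_image_eq (by rw [himg, hc]) (hall _)
    exact hinj ⟨x, rfl⟩ ⟨y, rfl⟩ (by rw [coarsen_ray, coarsen_ray, hxy])
  have hinj : Function.Injective fun x : EdgeShift A => ray x 0 := by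
    intro x y hxy
    have : ∀ n : ℕ, ray x n = ray y n := by
      intro n
      induction n with
      | zero => exact hxy
      | succ n ih => exact_mod_cast hstep n x y ih
    refine Subtype.ext (funext fun i => ?_)
    exact ray_eq_iff.1 (this i.toNat) i (by omega)
  have : Finite (EdgeShift A) := by
    have := (hall 0).to_subtype
    exact Finite.of_injective (fun x => (⟨ray x 0, x, rfl⟩ : range fun x : EdgeShift A => ray x 0))
      fun x y hxy => hinj (congrArg Subtype.val hxy)
  exact absurd h.entropy_pos (not_lt.2 (topEntropy_nonpos_of_finite _))

/-- Every vector over `ℤ₊` is `v_{V,m}` for an `m`-beam `V` that avoids a given `m`-beam. -/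
lemma PosIrreducible.exists_beam (h : PosIrreducible A) {U : Set (EdgeShift A)} {m : ℤ}
    (hU : IsBeam U m) (u : Fin k → ℕ) :
    ∃ V : Set (EdgeShift A), IsBeam V m ∧ Disjoint U V ∧ endCount V m = u := by
  have hinf : ∀ J, (endRays (A := A) univ m J \ endRays U m J).Infinite := fun J =>
    (h.endRays_univ_infinite m J).sdiff (endRays_finite hU J)
  have hex : ∀ J, ∃ t ⊆ endRays (A := A) univ m J \ endRays U m J, t.Finite ∧ t.ncard = u J :=
    fun J => (hinf J).exists_subset_ncard_eq (u J)
  choose t htsub htfin htcard using hex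
  have hmem : ∀ J, ∀ R ∈ t J, ∀ x ∈ R, ray x m = R ∧ (x.1 m).tgt = J := by
    intro J R hR x hx
    obtain ⟨y, -, hy, rfl⟩ := (htsub J hR).1
    exact ⟨ray_eq_iff.2 hx, by rw [hx m le_rfl, hy]⟩
  have hne : ∀ J, ∀ R ∈ t J, ∃ x, x ∈ R := by
    intro J R hR
    obtain ⟨y, -, hy, rfl⟩ := (htsub J hR).1
    exact ⟨y, fun _ _ => rfl⟩
  let V : Set (EdgeShift A) := {x | ∃ J, ray x m ∈ t J}
  have hV : ∀ J, endRays V m J = t J := by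
    intro J
    ext R
    constructor
    · rintro ⟨x, ⟨J', hx⟩, hJ, rfl⟩
      have := (hmem J' _ hx x fun _ _ => rfl).2
      rw [← hJ, this]
      exact hx
    · intro hR
      obtain ⟨x, hx⟩ := hne J R hR
      obtain ⟨h1, h2⟩ := hmem J R hR x hx
      exact ⟨x, ⟨J, h1 ▸ hR⟩, h2, h1⟩
  refine ⟨V, isBeam_iff.2 ⟨?_, ?_⟩, ?_, ?_⟩
  · rintro x ⟨J, hx⟩ y hy
    exact ⟨J, by rwa [ray_eq_iff.2 hy]⟩
  · refine (Set.finite_iUnion htfin).subset ?_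
    rintro _ ⟨x, ⟨J, hx⟩, rfl⟩
    exact mem_iUnion.2 ⟨J, hx⟩
  · rw [Set.disjoint_left]
    rintro x hx ⟨J, hxJ⟩
    exact (htsub J hxJ).2 ⟨x, hx, (hmem J _ hxJ x fun _ _ => rfl).2, rfl⟩
  · funext J
    rw [endCount, hV, htcard]

/-! ### The dimension triple of the matrix `A` -/

/-- `A` as a rational matrix; it acts on row vectors. -/
abbrev ratMatrix (A : Matrix (Fin k) (Fin k) ℕ) : Matrix (Fin k) (Fin k) ℚ :=
  A.map (Nat.cast : ℕ → ℚ)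

/-- The eventual range `R(A) = ℚ^k A^k`. -/
def eventualRange (A : Matrix (Fin k) (Fin k) ℕ) : Submodule ℚ (Fin k → ℚ) :=
  LinearMap.range (ratMatrix A ^ k).vecMulLinear

lemma ratMatrix_pow (m : ℕ) : ratMatrix A ^ m = (A ^ m).map (Nat.cast : ℕ → ℚ) :=
  (map_pow (Nat.castRingHom ℚ).mapMatrix A m).symm

lemma cast_vecMul (u : Fin k → ℕ) (m : ℕ) :
    (fun i => ((Matrix.vecMul u (A ^ m) i : ℕ) : ℚ)) =
      Matrix.vecMul (fun i => (u i : ℚ)) (ratMatrix A ^ m) := by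
  funext i
  rw [ratMatrix_pow]
  exact RingHom.map_vecMul (Nat.castRingHom ℚ) (A ^ m) u i

lemma cast_vecMul_int (u : Fin k → ℤ) (m : ℕ) :
    (fun i => ((Matrix.vecMul u ((A ^ m).map (Nat.cast : ℕ → ℤ)) i : ℤ) : ℚ)) =
      Matrix.vecMul (fun i => (u i : ℚ)) (ratMatrix A ^ m) := by
  funext i
  rw [ratMatrix_pow]
  have := RingHom.map_vecMul (Int.castRingHom ℚ) ((A ^ m).map (Nat.cast : ℕ → ℤ)) u i
  rw [Matrix.map_map] at this
  simpa [Function.comp_def] using this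

/-- `𝒢_A = {x ∈ R(A) | x A^m ∈ ℤ^k for some m ≥ 0}`. -/
def dimGroup (A : Matrix (Fin k) (Fin k) ℕ) : AddSubgroup (Fin k → ℚ) where
  carrier := {x | x ∈ eventualRange A ∧
    ∃ (m : ℕ) (u : Fin k → ℤ), Matrix.vecMul x (ratMatrix A ^ m) = fun i => (u i : ℚ)}
  zero_mem' := ⟨Submodule.zero_mem _, 0, 0, by ext; simp⟩
  add_mem' := by
    rintro x y ⟨hx, m, u, hu⟩ ⟨hy, n, v, hv⟩
    refine ⟨Submodule.add_mem _ hx hy, m + n,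
      Matrix.vecMul u ((A ^ n).map (Nat.cast : ℕ → ℤ)) +
        Matrix.vecMul v ((A ^ m).map (Nat.cast : ℕ → ℤ)), ?_⟩
    have h1 := cast_vecMul_int (A := A) u n
    have h2 := cast_vecMul_int (A := A) v m
    rw [Matrix.add_vecMul, pow_add, ← Matrix.vecMul_vecMul, hu, ← h1,
      ← pow_add, add_comm m n, pow_add, ← Matrix.vecMul_vecMul, hv, ← h2]
    ext i; simp
  neg_mem' := by
    rintro x ⟨hx, m, u, hu⟩
    refine ⟨Submodule.neg_mem _ hx, m, -u, ?_⟩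
    rw [Matrix.neg_vecMul, hu]
    ext; simp

/-- `𝒢_A⁺ = {x ∈ R(A) | x A^m ∈ (ℤ₊)^k for some m ≥ 0}`, as a subsemigroup of `𝒢_A`. -/
def dimCone (A : Matrix (Fin k) (Fin k) ℕ) : AddSubmonoid (dimGroup A) where
  carrier := {x | ∃ (m : ℕ) (u : Fin k → ℕ),
    Matrix.vecMul x.1 (ratMatrix A ^ m) = fun i => (u i : ℚ)}
  zero_mem' := ⟨0, 0, by ext; simp⟩
  add_mem' := by
    rintro x y ⟨m, u, hu⟩ ⟨n, v, hv⟩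
    refine ⟨m + n, Matrix.vecMul u (A ^ n) + Matrix.vecMul v (A ^ m), ?_⟩
    have h1 := cast_vecMul (A := A) u n
    have h2 := cast_vecMul (A := A) v m
    rw [AddSubgroup.coe_add, Matrix.add_vecMul, pow_add, ← Matrix.vecMul_vecMul, hu, ← h1,
      ← pow_add, add_comm m n, pow_add, ← Matrix.vecMul_vecMul, hv, ← h2]
    ext i; simp

lemma mem_eventualRange {x : Fin k → ℚ} :
    x ∈ eventualRange A ↔ ∃ y, Matrix.vecMul y (ratMatrix A ^ k) = x := Iff.rfl

lemma vecMul_mem_eventualRange {x : Fin k → ℚ} (hx : x ∈ eventualRange A) :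
    Matrix.vecMul x (ratMatrix A) ∈ eventualRange A := by
  obtain ⟨y, rfl⟩ := mem_eventualRange.1 hx
  exact ⟨Matrix.vecMul y (ratMatrix A), by
    rw [Matrix.vecMulLinear_apply, Matrix.vecMul_vecMul, Matrix.vecMul_vecMul, ← pow_succ',
      ← pow_succ]⟩

lemma vecMulLinear_pow (B : Matrix (Fin k) (Fin k) ℚ) (m : ℕ) :
    (B.vecMulLinear : Module.End ℚ (Fin k → ℚ)) ^ m = (B ^ m).vecMulLinear := by
  induction m with
  | zero => ext; simp
  | succ m ih =>
    refine LinearMap.ext fun x => ?_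
    rw [pow_succ', ih, Module.End.mul_apply, Matrix.vecMulLinear_apply, Matrix.vecMulLinear_apply,
      Matrix.vecMulLinear_apply, Matrix.vecMul_vecMul, pow_succ]

lemma eq_zero_of_vecMul_eq_zero {x : Fin k → ℚ} (hx : x ∈ eventualRange A)
    (h : Matrix.vecMul x (ratMatrix A) = 0) : x = 0 := by
  obtain ⟨y, rfl⟩ := mem_eventualRange.1 hx
  have hfin : Module.finrank ℚ (Fin k → ℚ) = k := by simp
  have hker := Module.End.ker_pow_eq_ker_pow_finrank_of_le
    (f := ((ratMatrix A).vecMulLinear : Module.End ℚ (Fin k → ℚ))) (m := k + 1) (by omega)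
  rw [hfin, vecMulLinear_pow, vecMulLinear_pow] at hker
  have : y ∈ LinearMap.ker (ratMatrix A ^ k).vecMulLinear := by
    rw [← hker, LinearMap.mem_ker, Matrix.vecMulLinear_apply, pow_succ, ← Matrix.vecMul_vecMul, h]
  exact this

lemma exists_vecMul_eq {x : Fin k → ℚ} (hx : x ∈ eventualRange A) :
    ∃ y ∈ eventualRange A, Matrix.vecMul y (ratMatrix A) = x := by
  let f : eventualRange A →ₗ[ℚ] eventualRange A :=
    (ratMatrix A).vecMulLinear.restrict fun x hx => vecMul_mem_eventualRange hx
  have hf : Function.Injective f := by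
    rw [← LinearMap.ker_eq_bot, LinearMap.ker_eq_bot']
    intro z hz
    exact Subtype.ext (eq_zero_of_vecMul_eq_zero z.2 (congrArg Subtype.val hz))
  obtain ⟨y, hy⟩ := LinearMap.injective_iff_surjective.1 hf ⟨x, hx⟩
  exact ⟨y, y.2, congrArg Subtype.val hy⟩

/-- `x ↦ x A` as an endomorphism of `𝒢_A`. -/
def dimShiftHom (A : Matrix (Fin k) (Fin k) ℕ) : dimGroup A →+ dimGroup A where
  toFun x := ⟨Matrix.vecMul x.1 (ratMatrix A), vecMul_mem_eventualRange x.2.1, by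
    obtain ⟨m, u, hu⟩ := x.2.2
    refine ⟨m, Matrix.vecMul u ((A ^ 1).map (Nat.cast : ℕ → ℤ)), ?_⟩
    rw [cast_vecMul_int, ← hu, Matrix.vecMul_vecMul, Matrix.vecMul_vecMul, pow_one, ← pow_succ,
      ← pow_succ']⟩
  map_zero' := Subtype.ext (Matrix.zero_vecMul (ratMatrix A))
  map_add' x y := Subtype.ext (Matrix.add_vecMul (ratMatrix A) x.1 y.1)

lemma coe_dimShiftHom (x : dimGroup A) :
    (dimShiftHom A x : Fin k → ℚ) = Matrix.vecMul x.1 (ratMatrix A) := rfl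

lemma dimShiftHom_bijective : Function.Bijective (dimShiftHom A) := by
  constructor
  · rw [injective_iff_map_eq_zero]
    intro x hx
    exact Subtype.ext (eq_zero_of_vecMul_eq_zero x.2.1 (congrArg Subtype.val hx))
  · rintro ⟨x, hx, m, u, hu⟩
    obtain ⟨y, hy, rfl⟩ := exists_vecMul_eq hx
    refine ⟨⟨y, hy, m + 1, u, ?_⟩, rfl⟩
    rw [← hu, Matrix.vecMul_vecMul, ← pow_succ']

/-- The group (under composition) of automorphisms of an abelian group `G`; a group automorphism
is the same thing as a `ℤ`-linear one. -/
abbrev GroupAut (G : Type*) [AddCommGroup G] : Type _ := G ≃ₗ[ℤ] G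

/-- The automorphism `δ_A : x ↦ x A` of `𝒢_A`. -/
noncomputable def dimShift (A : Matrix (Fin k) (Fin k) ℕ) : GroupAut (dimGroup A) :=
  (AddEquiv.ofBijective (dimShiftHom A) dimShiftHom_bijective).toIntLinearEquiv

lemma coe_dimShift (x : dimGroup A) :
    (dimShift A x : Fin k → ℚ) = Matrix.vecMul x.1 (ratMatrix A) := rfl

lemma coe_dimShift_pow (n : ℕ) (x : dimGroup A) :
    ((dimShift A ^ n) x : Fin k → ℚ) = Matrix.vecMul x.1 (ratMatrix A ^ n) := by
  induction n with
  | zero => simp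
  | succ n ih =>
    rw [pow_succ', LinearEquiv.mul_apply, coe_dimShift, ih, Matrix.vecMul_vecMul, pow_succ]

/-- `Aut(𝒢_A, 𝒢_A⁺, δ_A)`: the group automorphisms of `𝒢_A` that take `𝒢_A⁺` onto `𝒢_A⁺` and
commute with `δ_A`. -/
def DimAut (A : Matrix (Fin k) (Fin k) ℕ) : Subgroup (GroupAut (dimGroup A)) where
  carrier := {Φ | Φ '' (dimCone A : Set (dimGroup A)) = dimCone A ∧
    Φ * dimShift A = dimShift A * Φ}
  one_mem' := ⟨by simp, by simp⟩
  mul_mem' := by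
    rintro Φ Ψ ⟨h1, h2⟩ ⟨h3, h4⟩
    refine ⟨?_, ?_⟩
    · have : (⇑(Φ * Ψ) : dimGroup A → dimGroup A) = Φ ∘ Ψ := rfl
      rw [this, image_comp, h3, h1]
    · rw [mul_assoc, h4, ← mul_assoc, h2, mul_assoc]
  inv_mem' := by
    rintro Φ ⟨h1, h2⟩
    refine ⟨?_, ?_⟩
    · conv_lhs => rw [← h1]
      rw [← image_comp]
      have : (⇑(Φ⁻¹) ∘ ⇑Φ : dimGroup A → dimGroup A) = id := by
        funext x; exact LinearEquiv.symm_apply_apply Φ x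
      rw [this, image_id]
    · exact ((show Commute Φ (dimShift A) from h2).inv_left).eq

/-! ### Krieger's dimension triple and the dimension representation -/

/-- Beams: sets that are `m`-beams for some `m`. -/
def Beam (A : Matrix (Fin k) (Fin k) ℕ) : Type := {U : Set (EdgeShift A) // ∃ m, IsBeam U m}

/-- Beams `U`, `V` are equivalent if `v_{U,m} = v_{V,m}` for some `m` (for which both are
`m`-beams). -/
def BeamEquiv (U V : Beam A) : Prop :=
  ∃ m, IsBeam U.1 m ∧ IsBeam V.1 m ∧ endCount U.1 m = endCount V.1 m

lemma PosIrreducible.endCount_eq_mono (h : PosIrreducible A) {U V : Set (EdgeShift A)} {m n : ℤ}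
    (hU : IsBeam U m) (hV : IsBeam V m) (he : endCount U m = endCount V m) (hmn : m ≤ n) :
    endCount U n = endCount V n := by
  obtain ⟨d, rfl⟩ := Int.le.dest hmn
  rw [h.endCount_add hU, h.endCount_add hV, he]

/-- Equivalence of beams, as a setoid. -/
def beamSetoid (h : PosIrreducible A) : Setoid (Beam A) where
  r := BeamEquiv
  iseqv := {
    refl := fun U => ⟨U.2.choose, U.2.choose_spec, U.2.choose_spec, rfl⟩
    symm := fun ⟨m, h1, h2, h3⟩ => ⟨m, h2, h1, h3.symm⟩
    trans := by
      rintro U V W ⟨m, h1, h2, h3⟩ ⟨n, h4, h5, h6⟩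
      refine ⟨max m n, h1.mono (le_max_left _ _), h5.mono (le_max_right _ _), ?_⟩
      rw [h.endCount_eq_mono h1 h2 h3 (le_max_left _ _),
        h.endCount_eq_mono h4 h5 h6 (le_max_right _ _)] }

/-- The set `D_A⁺` of equivalence classes of beams. -/
def KriegerCone (h : PosIrreducible A) : Type := Quotient (beamSetoid h)

/-- The class `[U]` of a beam. -/
def KriegerCone.mk (h : PosIrreducible A) (U : Beam A) : KriegerCone h :=
  Quotient.mk (beamSetoid h) U

lemma KriegerCone.mk_eq_iff {h : PosIrreducible A} {U V : Beam A} :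
    KriegerCone.mk h U = KriegerCone.mk h V ↔ BeamEquiv U V :=
  Quotient.eq (r := beamSetoid h)

lemma KriegerCone.mk_surjective {h : PosIrreducible A} (a : KriegerCone h) :
    ∃ U, KriegerCone.mk h U = a := Quotient.exists_rep a

/-- The union of two beams. -/
def Beam.union (U V : Beam A) : Beam A :=
  ⟨U.1 ∪ V.1, by
    obtain ⟨m, hm⟩ := U.2
    obtain ⟨n, hn⟩ := V.2
    exact ⟨max m n, (hm.mono (le_max_left _ _)).union (hn.mono (le_max_right _ _))⟩⟩

/-- The empty beam. -/
def Beam.empty (A : Matrix (Fin k) (Fin k) ℕ) : Beam A := ⟨∅, 0, ∅, Set.finite_empty, by simp⟩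

/-- Two classes of beams have disjoint representatives. -/
lemma KriegerCone.exists_disjoint {h : PosIrreducible A} (a b : KriegerCone h) :
    ∃ p : Beam A × Beam A, KriegerCone.mk h p.1 = a ∧ KriegerCone.mk h p.2 = b ∧
      Disjoint p.1.1 p.2.1 := by
  obtain ⟨U, rfl⟩ := a.mk_surjective
  obtain ⟨V, rfl⟩ := b.mk_surjective
  obtain ⟨m, hm⟩ := U.2
  obtain ⟨n, hn⟩ := V.2
  obtain ⟨W, hW, hd, hc⟩ := h.exists_beam (hm.mono (le_max_left m n)) (endCount V.1 (max m n))
  exact ⟨⟨U, ⟨W, _, hW⟩⟩, rfl,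
    KriegerCone.mk_eq_iff.2 ⟨_, hW, hn.mono (le_max_right m n), hc⟩, hd⟩

/-- `[U] + [V] = [U' ∪ V']` where `[U] = [U']`, `[V] = [V']` and `U' ∩ V' = ∅`. -/
noncomputable instance (h : PosIrreducible A) : Add (KriegerCone h) where
  add a b := KriegerCone.mk h
    ((KriegerCone.exists_disjoint a b).choose.1.union (KriegerCone.exists_disjoint a b).choose.2)

instance (h : PosIrreducible A) : Zero (KriegerCone h) where
  zero := KriegerCone.mk h (Beam.empty A)

lemma BeamEquiv.union {h : PosIrreducible A} {U V U' V' : Beam A} (hU : BeamEquiv U U')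
    (hV : BeamEquiv V V') (hd : Disjoint U.1 V.1) (hd' : Disjoint U'.1 V'.1) :
    BeamEquiv (U.union V) (U'.union V') := by
  obtain ⟨m, h1, h2, h3⟩ := hU
  obtain ⟨n, h4, h5, h6⟩ := hV
  have h1' := h1.mono (le_max_left m n)
  have h2' := h2.mono (le_max_left m n)
  have h4' := h4.mono (le_max_right m n)
  have h5' := h5.mono (le_max_right m n)
  refine ⟨max m n, h1'.union h4', h2'.union h5', ?_⟩
  funext J
  change endCount (U.1 ∪ V.1) _ J = endCount (U'.1 ∪ V'.1) _ J
  rw [endCount_union h1' h4' hd, endCount_union h2' h5' hd',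
    h.endCount_eq_mono h1 h2 h3 (le_max_left _ _), h.endCount_eq_mono h4 h5 h6 (le_max_right _ _)]

/-- The sum can be computed from any disjoint representatives. -/
lemma KriegerCone.mk_add_mk {h : PosIrreducible A} {U V : Beam A} (hd : Disjoint U.1 V.1) :
    KriegerCone.mk h U + KriegerCone.mk h V = KriegerCone.mk h (U.union V) := by
  have hs := (KriegerCone.exists_disjoint (KriegerCone.mk h U) (KriegerCone.mk h V)).choose_spec
  exact KriegerCone.mk_eq_iff.2 (BeamEquiv.union (h := h) (KriegerCone.mk_eq_iff.1 hs.1)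
    (KriegerCone.mk_eq_iff.1 hs.2.1) hs.2.2 hd)

/-- The vector `v A^k ∈ 𝒢_A`, for `v ∈ (ℤ₊)^k`. -/
def ofVec (A : Matrix (Fin k) (Fin k) ℕ) (v : Fin k → ℕ) : dimGroup A :=
  ⟨Matrix.vecMul (fun i => (v i : ℚ)) (ratMatrix A ^ k), ⟨_, rfl⟩, 0,
    fun i => ((Matrix.vecMul v (A ^ k) i : ℕ) : ℤ), by
      rw [← cast_vecMul]; ext; simp⟩

/-- `δ_A^{-k-n}(v_{U,n} A^k)`. -/
noncomputable def thetaAt (U : Set (EdgeShift A)) (n : ℤ) : dimGroup A :=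
  (dimShift A ^ (-(k : ℤ) - n)) (ofVec A (endCount U n))

lemma coe_ofVec (v : Fin k → ℕ) : (ofVec A v : Fin k → ℚ) =
    Matrix.vecMul (fun i => (v i : ℚ)) (ratMatrix A ^ k) := rfl

lemma ofVec_vecMul (v : Fin k → ℕ) (m : ℕ) :
    ofVec A (Matrix.vecMul v (A ^ m)) = (dimShift A ^ m) (ofVec A v) := by
  refine Subtype.ext ?_
  rw [coe_dimShift_pow, coe_ofVec, coe_ofVec, cast_vecMul, Matrix.vecMul_vecMul, Matrix.vecMul_vecMul, ← pow_add, ← pow_add, add_comm]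

lemma thetaAt_mono (h : PosIrreducible A) {U : Set (EdgeShift A)} {m n : ℤ} (hU : IsBeam U m)
    (hmn : m ≤ n) : thetaAt U n = thetaAt U m := by
  obtain ⟨d, rfl⟩ := Int.le.dest hmn
  rw [thetaAt, thetaAt, h.endCount_add hU, ofVec_vecMul, ← zpow_natCast, ← LinearEquiv.mul_apply,
    ← zpow_add]
  congr 2; ring

lemma thetaAt_eq (h : PosIrreducible A) {U : Set (EdgeShift A)} {m n : ℤ} (hm : IsBeam U m)
    (hn : IsBeam U n) : thetaAt U n = thetaAt U m := by
  rw [← thetaAt_mono h hm (le_max_left m n), ← thetaAt_mono h hn (le_max_right m n)]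

/-- `θ([U]) = δ_A^{-k-n}(v_{U,n} A^k)` for an `n`-beam `U`. -/
noncomputable def KriegerCone.theta {h : PosIrreducible A} : KriegerCone h → dimGroup A :=
  Quotient.lift (fun U : Beam A => thetaAt U.1 U.2.choose) (by
    rintro U V ⟨m, h1, h2, h3⟩
    rw [thetaAt_eq h h1 U.2.choose_spec, thetaAt_eq h h2 V.2.choose_spec, thetaAt, thetaAt, h3])

lemma KriegerCone.theta_mk {h : PosIrreducible A} {U : Beam A} {n : ℤ} (hn : IsBeam U.1 n) :
    (KriegerCone.mk h U).theta = (dimShift A ^ (-(k : ℤ) - n)) (ofVec A (endCount U.1 n)) :=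
  thetaAt_eq h hn U.2.choose_spec

lemma KriegerCone.theta_injective {h : PosIrreducible A} :
    Function.Injective (KriegerCone.theta (h := h)) := by
  intro a b hab
  obtain ⟨U, rfl⟩ := a.mk_surjective
  obtain ⟨V, rfl⟩ := b.mk_surjective
  obtain ⟨m, hm⟩ := U.2
  obtain ⟨n, hn⟩ := V.2
  have hm' := hm.mono (le_max_left m n)
  have hn' := hn.mono (le_max_right m n)
  rw [KriegerCone.theta_mk hm', KriegerCone.theta_mk hn'] at hab
  have h1 := congrArg Subtype.val ((dimShift A ^ (-(k : ℤ) - max m n)).injective hab)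
  rw [coe_ofVec, coe_ofVec, ← cast_vecMul, ← cast_vecMul] at h1
  refine KriegerCone.mk_eq_iff.2 ⟨max m n + k, hm'.mono (by omega), hn'.mono (by omega), ?_⟩
  rw [h.endCount_add hm', h.endCount_add hn']
  funext i
  exact_mod_cast congrFun h1 i

lemma ofVec_add (u v : Fin k → ℕ) : ofVec A (u + v) = ofVec A u + ofVec A v := by
  refine Subtype.ext ?_
  rw [AddSubgroup.coe_add, coe_ofVec, coe_ofVec, coe_ofVec, ← Matrix.add_vecMul]
  congr 1
  ext i; simp

lemma ofVec_zero : ofVec A (0 : Fin k → ℕ) = 0 := by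
  have h := ofVec_add (A := A) 0 0
  rw [add_zero] at h
  exact left_eq_add.1 h

lemma endCount_empty (m : ℤ) : endCount (∅ : Set (EdgeShift A)) m = 0 := by
  funext J
  simp [endCount, endRays]

lemma isBeam_empty (m : ℤ) : IsBeam (∅ : Set (EdgeShift A)) m := ⟨∅, Set.finite_empty, by simp⟩

lemma KriegerCone.theta_zero {h : PosIrreducible A} : (0 : KriegerCone h).theta = 0 := by
  refine (KriegerCone.theta_mk (U := Beam.empty A) (isBeam_empty 0)).trans ?_
  rw [show (Beam.empty A).1 = ∅ from rfl, endCount_empty, ofVec_zero, map_zero]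

lemma KriegerCone.theta_add {h : PosIrreducible A} (a b : KriegerCone h) :
    (a + b).theta = a.theta + b.theta := by
  obtain ⟨⟨U, V⟩, rfl, rfl, hd⟩ := KriegerCone.exists_disjoint a b
  obtain ⟨m, hm⟩ := U.2
  obtain ⟨n, hn⟩ := V.2
  have hm' := hm.mono (le_max_left m n)
  have hn' := hn.mono (le_max_right m n)
  rw [KriegerCone.mk_add_mk hd, KriegerCone.theta_mk hm', KriegerCone.theta_mk hn',
    KriegerCone.theta_mk (U := U.union V) (hm'.union hn'), ← map_add, ← ofVec_add]
  congr 2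
  funext J
  exact endCount_union hm' hn' hd J

/-- The abelian semigroup `D_A⁺`. -/
noncomputable instance (h : PosIrreducible A) : AddCommMonoid (KriegerCone h) where
  add_assoc a b c := KriegerCone.theta_injective (by simp only [KriegerCone.theta_add, add_assoc])
  zero_add a := KriegerCone.theta_injective (by
    simp only [KriegerCone.theta_add, KriegerCone.theta_zero, zero_add])
  add_zero a := KriegerCone.theta_injective (by
    simp only [KriegerCone.theta_add, KriegerCone.theta_zero, add_zero])
  add_comm a b := KriegerCone.theta_injective (by simp only [KriegerCone.theta_add, add_comm])
  nsmul := nsmulRec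

/-- `D_A`, the group completion of `D_A⁺`. -/
abbrev KriegerGroup (h : PosIrreducible A) : Type := Algebra.GrothendieckAddGroup (KriegerCone h)

/-- `θ : D_A⁺ → 𝒢_A` as a homomorphism. -/
noncomputable def KriegerCone.thetaHom (h : PosIrreducible A) : KriegerCone h →+ dimGroup A where
  toFun := KriegerCone.theta
  map_zero' := KriegerCone.theta_zero
  map_add' := KriegerCone.theta_add

/-- `θ(D_A⁺) = 𝒢_A⁺`. -/
lemma KriegerCone.range_theta (h : PosIrreducible A) :
    range (KriegerCone.theta (h := h)) = (dimCone A : Set (dimGroup A)) := by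
  ext x
  constructor
  · rintro ⟨a, rfl⟩
    obtain ⟨U, rfl⟩ := a.mk_surjective
    obtain ⟨m, hm⟩ := U.2
    have hm' := hm.mono (le_max_left m 0)
    obtain ⟨d, hd⟩ := Int.eq_ofNat_of_zero_le (le_max_right m 0)
    refine ⟨k + d, Matrix.vecMul (endCount U.1 (max m 0)) (A ^ k), ?_⟩
    rw [← coe_dimShift_pow, KriegerCone.theta_mk hm', ← zpow_natCast, ← LinearEquiv.mul_apply,
      ← zpow_add, hd, cast_vecMul]
    rw [show ((k + d : ℕ) : ℤ) + (-(k : ℤ) - (d : ℤ)) = 0 by push_cast; ring, zpow_zero]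
    rfl
  · rintro ⟨m, u, hu⟩
    obtain ⟨V, hV, -, hc⟩ := h.exists_beam (isBeam_empty (m : ℤ)) u
    refine ⟨KriegerCone.mk h ⟨V, _, hV⟩, ?_⟩
    rw [KriegerCone.theta_mk (U := ⟨V, _, hV⟩) hV, hc]
    have : ofVec A u = (dimShift A ^ ((k : ℤ) + m)) x := by
      refine Subtype.ext ?_
      rw [show (k : ℤ) + m = ((m + k : ℕ) : ℤ) by push_cast; ring, zpow_natCast, coe_dimShift_pow,
        pow_add, ← Matrix.vecMul_vecMul, hu]
      rfl
    rw [this, ← LinearEquiv.mul_apply, ← zpow_add,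
      show -(k : ℤ) - m + (k + m) = 0 by ring, zpow_zero]; rfl

lemma dimGroup_eq_sub (x : dimGroup A) : ∃ a ∈ dimCone A, ∃ b ∈ dimCone A, x = a - b := by
  obtain ⟨m, u, hu⟩ := x.2.2
  have hcone : ∀ v : Fin k → ℕ, (dimShift A ^ (-(k : ℤ) - m)) (ofVec A v) ∈ dimCone A := by
    intro v
    refine ⟨k + m, Matrix.vecMul v (A ^ k), ?_⟩
    rw [← coe_dimShift_pow, ← zpow_natCast, ← LinearEquiv.mul_apply, ← zpow_add, cast_vecMul]
    rw [show ((k + m : ℕ) : ℤ) + (-(k : ℤ) - (m : ℤ)) = 0 by push_cast; ring, zpow_zero]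
    rfl
  refine ⟨_, hcone fun i => (u i).toNat, _, hcone fun i => (-u i).toNat, ?_⟩
  rw [← map_sub]
  have : ofVec A (fun i => (u i).toNat) - ofVec A (fun i => (-u i).toNat) =
      (dimShift A ^ ((k : ℤ) + m)) x := by
    refine Subtype.ext ?_
    rw [show (k : ℤ) + m = ((m + k : ℕ) : ℤ) by push_cast; ring, zpow_natCast, coe_dimShift_pow,
        pow_add, ← Matrix.vecMul_vecMul, hu]
    rw [AddSubgroup.coe_sub, coe_ofVec, coe_ofVec, ← Matrix.sub_vecMul]
    congr 1
    ext i
    have : ((u i).toNat : ℤ) - ((-u i).toNat : ℤ) = u i := by omega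
    simp only [Pi.sub_apply]
    exact_mod_cast this
  rw [this, ← LinearEquiv.mul_apply, ← zpow_add,
      show -(k : ℤ) - m + (k + m) = 0 by ring, zpow_zero]; rfl

/-- Elements of `D_A` are formal differences. -/
lemma KriegerGroup.exists_sub {h : PosIrreducible A} (x : KriegerGroup h) :
    ∃ a b : KriegerCone h, x = Algebra.GrothendieckAddGroup.of a -
      Algebra.GrothendieckAddGroup.of b := by
  induction x using AddLocalization.ind with
  | _ y =>
    obtain ⟨a, b, hb⟩ := y
    refine ⟨a, b, ?_⟩
    have hof : ∀ c : KriegerCone h,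
        Algebra.GrothendieckAddGroup.of c = AddLocalization.mk c (0 : (⊤ : AddSubmonoid _)) :=
      fun c => (AddLocalization.mk_zero_eq_addMonoidOf_mk c).symm
    rw [hof, hof, Algebra.GrothendieckAddGroup.mk_sub_mk]
    congr 1
    · simp
    · exact Subtype.ext (by simp)

lemma KriegerGroup.lift_of {h : PosIrreducible A} {G : Type*} [AddCommGroup G]
    (f : KriegerCone h →+ G) (a : KriegerCone h) :
    Algebra.GrothendieckAddGroup.lift f (Algebra.GrothendieckAddGroup.of a) = f a :=
  DFunLike.congr_fun (Algebra.GrothendieckAddGroup.lift.symm_apply_apply f) a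

/-- The isomorphism `θ : D_A → 𝒢_A` induced by `θ : D_A⁺ → 𝒢_A⁺`. -/
noncomputable def theta (h : PosIrreducible A) : KriegerGroup h ≃+ dimGroup A :=
  AddEquiv.ofBijective (Algebra.GrothendieckAddGroup.lift (KriegerCone.thetaHom h)) (by
    constructor
    · rw [injective_iff_map_eq_zero]
      intro x hx
      obtain ⟨a, b, rfl⟩ := KriegerGroup.exists_sub x
      rw [map_sub, KriegerGroup.lift_of, KriegerGroup.lift_of, sub_eq_zero] at hx
      rw [KriegerCone.theta_injective hx, sub_self]
    · intro x
      obtain ⟨a, ha, b, hb, rfl⟩ := dimGroup_eq_sub x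
      rw [← SetLike.mem_coe, ← KriegerCone.range_theta h] at ha hb
      obtain ⟨a, rfl⟩ := ha
      obtain ⟨b, rfl⟩ := hb
      refine ⟨Algebra.GrothendieckAddGroup.of a - Algebra.GrothendieckAddGroup.of b, ?_⟩
      rw [map_sub, KriegerGroup.lift_of, KriegerGroup.lift_of]
      rfl)

lemma theta_of (h : PosIrreducible A) (a : KriegerCone h) :
    theta h (Algebra.GrothendieckAddGroup.of a) = a.theta :=
  KriegerGroup.lift_of _ a

/-- The image `φ(U)` of a beam. -/
def Beam.map (φ : AutShift A) (U : Beam A) : Beam A :=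
  ⟨φ.1 '' U.1, by
    obtain ⟨m, hm⟩ := U.2
    obtain ⟨N, hN, hN'⟩ := AutShift.exists_window₂ φ
    exact ⟨_, hm.image_aut φ hN hN'⟩⟩

lemma BeamEquiv.map (φ : AutShift A) {U V : Beam A} (hUV : BeamEquiv U V) :
    BeamEquiv (U.map φ) (V.map φ) := by
  obtain ⟨m, h1, h2, h3⟩ := hUV
  obtain ⟨N, hN, hN'⟩ := AutShift.exists_window₂ φ
  exact ⟨_, (h1.image_aut φ hN hN').mono (by omega), (h2.image_aut φ hN hN').mono (by omega),
    endCount_image_aut φ hN hN' h1 h2 h3⟩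

/-- `φ_* : D_A⁺ → D_A⁺`, `φ_*([U]) = [φ(U)]`. -/
def KriegerCone.map (h : PosIrreducible A) (φ : AutShift A) : KriegerCone h →+ KriegerCone h where
  toFun := Quotient.map (Beam.map φ) fun _ _ hUV => BeamEquiv.map φ hUV
  map_zero' := by
    change KriegerCone.mk h (Beam.map φ (Beam.empty A)) = KriegerCone.mk h (Beam.empty A)
    congr 1
    exact Subtype.ext (image_empty _)
  map_add' a b := by
    obtain ⟨⟨U, V⟩, rfl, rfl, hd⟩ := KriegerCone.exists_disjoint a b
    rw [KriegerCone.mk_add_mk hd]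
    change KriegerCone.mk h (Beam.map φ (U.union V)) =
      KriegerCone.mk h (Beam.map φ U) + KriegerCone.mk h (Beam.map φ V)
    rw [KriegerCone.mk_add_mk ((Set.disjoint_image_iff φ.1.injective).2 hd)]
    congr 1
    exact Subtype.ext (image_union _ _ _)

lemma KriegerCone.map_mk (h : PosIrreducible A) (φ : AutShift A) (U : Beam A) :
    KriegerCone.map h φ (KriegerCone.mk h U) = KriegerCone.mk h (U.map φ) := rfl

/-- The map `φ_* : D_A → D_A` induced on the group completion. -/
noncomputable def KriegerGroup.map (h : PosIrreducible A) (φ : AutShift A) :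
    KriegerGroup h →+ KriegerGroup h :=
  Algebra.GrothendieckAddGroup.lift (Algebra.GrothendieckAddGroup.of.comp (KriegerCone.map h φ))

lemma KriegerGroup.map_of (h : PosIrreducible A) (φ : AutShift A) (a : KriegerCone h) :
    KriegerGroup.map h φ (Algebra.GrothendieckAddGroup.of a) =
      Algebra.GrothendieckAddGroup.of (KriegerCone.map h φ a) := KriegerGroup.lift_of _ a

lemma KriegerGroup.map_one (h : PosIrreducible A) (x : KriegerGroup h) :
    KriegerGroup.map h 1 x = x := by
  have h1 : ∀ a, KriegerCone.map h 1 a = a := by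
    intro a
    obtain ⟨U, rfl⟩ := a.mk_surjective
    rw [KriegerCone.map_mk]
    congr 1
    exact Subtype.ext (image_id _)
  obtain ⟨a, b, rfl⟩ := KriegerGroup.exists_sub x
  rw [map_sub, KriegerGroup.map_of, KriegerGroup.map_of, h1, h1]

lemma KriegerGroup.map_mul (h : PosIrreducible A) (φ ψ : AutShift A) (x : KriegerGroup h) :
    KriegerGroup.map h (φ * ψ) x = KriegerGroup.map h φ (KriegerGroup.map h ψ x) := by
  have h1 : ∀ a, KriegerCone.map h (φ * ψ) a = KriegerCone.map h φ (KriegerCone.map h ψ a) := by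
    intro a
    obtain ⟨U, rfl⟩ := a.mk_surjective
    rw [KriegerCone.map_mk, KriegerCone.map_mk, KriegerCone.map_mk]
    congr 1
    exact Subtype.ext (image_comp φ.1 ψ.1 U.1)
  obtain ⟨a, b, rfl⟩ := KriegerGroup.exists_sub x
  simp only [map_sub, KriegerGroup.map_of, h1]

/-- The automorphism `φ_*` of `D_A`. -/
noncomputable def kriegerAut (h : PosIrreducible A) (φ : AutShift A) :
    KriegerGroup h ≃+ KriegerGroup h where
  toFun := KriegerGroup.map h φ
  invFun := KriegerGroup.map h φ⁻¹
  left_inv x := by rw [← KriegerGroup.map_mul, inv_mul_cancel, KriegerGroup.map_one]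
  right_inv x := by rw [← KriegerGroup.map_mul, mul_inv_cancel, KriegerGroup.map_one]
  map_add' := map_add _

/-- `S_φ = θ ∘ φ_* ∘ θ⁻¹`, the automorphism of `𝒢_A` with `S_φ ∘ θ = θ ∘ φ_*`. -/
noncomputable def dimAut (h : PosIrreducible A) (φ : AutShift A) : GroupAut (dimGroup A) :=
  (((theta h).symm.trans (kriegerAut h φ)).trans (theta h)).toIntLinearEquiv

lemma dimAut_theta (h : PosIrreducible A) (φ : AutShift A) (x : KriegerGroup h) :
    dimAut h φ (theta h x) = theta h (KriegerGroup.map h φ x) := by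
  change theta h (KriegerGroup.map h φ ((theta h).symm (theta h x))) = _
  rw [AddEquiv.symm_apply_apply]

lemma dimAut_mul (h : PosIrreducible A) (φ ψ : AutShift A) :
    dimAut h (φ * ψ) = dimAut h φ * dimAut h ψ := by
  ext1 x
  obtain ⟨x, rfl⟩ := (theta h).surjective x
  rw [LinearEquiv.mul_apply, dimAut_theta, dimAut_theta, dimAut_theta, KriegerGroup.map_mul]

/-- The shift, as an element of `Aut(σ_A)`. -/
def shiftAut (A : Matrix (Fin k) (Fin k) ℕ) : AutShift A :=
  ⟨shift A, Subgroup.mem_centralizer_singleton_iff.2 rfl⟩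

/-- `S_{σ_A} = δ_A`. -/
lemma dimAut_shiftAut (h : PosIrreducible A) : dimAut h (shiftAut A) = dimShift A := by
  ext1 x
  obtain ⟨x, rfl⟩ := (theta h).surjective x
  obtain ⟨a, b, rfl⟩ := KriegerGroup.exists_sub x
  have h1 : ∀ a : KriegerCone h, (KriegerCone.map h (shiftAut A) a).theta =
      dimShift A a.theta := by
    intro a
    obtain ⟨U, rfl⟩ := a.mk_surjective
    obtain ⟨m, hm⟩ := U.2
    have hray : ∀ x : EdgeShift A, (shift A) '' ray x m = ray (shift A x) (m - 1) := by
      intro x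
      have := image_zpow_ray 1 x m
      simpa using this
    have hinj : Function.Injective fun R : Set (EdgeShift A) => (shift A) '' R :=
      Set.image_injective.2 (shift A).injective
    have hb : IsBeam (U.map (shiftAut A)).1 (m - 1) := by
      obtain ⟨s, hs, hU⟩ := hm
      refine ⟨(shift A) '' s, hs.image _, ?_⟩
      change (shift A) '' U.1 = _
      rw [hU, image_iUnion₂, biUnion_image]
      simp only [hray]
    have hc : endCount (U.map (shiftAut A)).1 (m - 1) = endCount U.1 m := by
      funext J
      unfold endCount
      rw [← Set.ncard_image_of_injective (endRays U.1 m J) hinj]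
      congr 1
      have hlast : ∀ x : EdgeShift A, (shift A x).1 (m - 1) = x.1 m := fun x => by
        change x.1 (m - 1 + 1) = _
        rw [sub_add_cancel]
      ext R
      constructor
      · rintro ⟨_, ⟨x, hx, rfl⟩, hJ, rfl⟩
        refine ⟨_, ⟨x, hx, ?_, rfl⟩, hray x⟩
        rw [← hJ]; exact (congrArg Edge.tgt (hlast x)).symm
      · rintro ⟨_, ⟨x, hx, hJ, rfl⟩, rfl⟩
        exact ⟨_, ⟨x, hx, rfl⟩, (congrArg Edge.tgt (hlast x)).trans hJ, (hray x).symm⟩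
    rw [KriegerCone.map_mk, KriegerCone.theta_mk hb, hc, KriegerCone.theta_mk hm,
      ← LinearEquiv.mul_apply, ← zpow_one_add]
    congr 2; ring
  rw [dimAut_theta]
  simp only [map_sub, KriegerGroup.map_of, theta_of, h1]

lemma dimAut_mem (h : PosIrreducible A) (φ : AutShift A) : dimAut h φ ∈ DimAut A := by
  have key : ∀ φ : AutShift A, dimAut h φ '' (dimCone A : Set (dimGroup A)) ⊆ dimCone A := by
    rintro φ _ ⟨x, hx, rfl⟩
    rw [← KriegerCone.range_theta h] at hx ⊢
    obtain ⟨a, rfl⟩ := hx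
    refine ⟨KriegerCone.map h φ a, ?_⟩
    rw [← theta_of, ← theta_of, dimAut_theta, KriegerGroup.map_of]
  refine ⟨subset_antisymm (key φ) ?_, ?_⟩
  · intro x hx
    refine ⟨dimAut h φ⁻¹ x, key φ⁻¹ ⟨x, hx, rfl⟩, ?_⟩
    rw [← LinearEquiv.mul_apply, ← dimAut_mul, mul_inv_cancel]
    obtain ⟨x, rfl⟩ := (theta h).surjective x
    rw [dimAut_theta, KriegerGroup.map_one]
  · rw [← dimAut_shiftAut h, ← dimAut_mul, ← dimAut_mul]
    congr 1
    exact Subtype.ext (Subgroup.mem_centralizer_singleton_iff.1 φ.2)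

/-- The dimension representation `π_A : Aut(σ_A) → Aut(𝒢_A, 𝒢_A⁺, δ_A)`, `φ ↦ S_φ`. -/
noncomputable def dimensionRepresentation (h : PosIrreducible A) : AutShift A →* DimAut A :=
  MonoidHom.mk' (fun φ => ⟨dimAut h φ, dimAut_mem h φ⟩) fun φ ψ => Subtype.ext (dimAut_mul h φ ψ)

/-- An automorphism is inert if it lies in the kernel of the dimension representation. -/
def IsInert (h : PosIrreducible A) (φ : AutShift A) : Prop := φ ∈ (dimensionRepresentation h).ker

end SFT

namespace SFT

open Set Topology Filter

variable {k : ℕ} {A : Matrix (Fin k) (Fin k) ℕ}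

/-! Let w be a Perron eigenvector, A w = l w with l > 0 and w > 0, and put τ(x) = ∑ x_i w_i
(`pairing`). Then τ ∘ δ_A = l τ, τ is non-negative on 𝒢_A⁺, and through θ it becomes a weight on
beams: each n-ray ending at J contributes l^(-n) w_J.

Algebra: irreducibility of det(I - tA) makes R(A) a simple ℚ[A]-module
(`eventualRange_le_of_invariant`). Therefore τ is injective on R(A), and every automorphism Φ of the
dimension triple satisfies τ ∘ Φ = s τ for some s > 0 (`IsPerron.exists_scale`).

Dynamics: let s be the factor of S_φ. The φ^n-image of a 0-ray has s^n times the weight of that ray,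
so it meets at least a constant times s^n distinct 0-rays (`IsPerron.pairing_thetaAt_le`). Pick one
point in each and pull it back by φ^n into the original 0-ray. Any two pulled-back points have the
same past up to time 0, whereas their φ^n-images do not. If φ has coding range N, a difference can
enter the coordinates ≤ 0 only through the coordinates 1, …, N (`ray_pow_eq`), so the two orbits
differ on the window [-N, N] at some time j < n. Exponentially many separated orbit segments give
positive entropy when s > 1. For s < 1 the same argument runs for φ⁻¹, whose orbit segments are
those of φ read backwards.

Zero entropy thus forces s = 1. Then τ vanishes on S_φ x - x, and injectivity of τ yields S_φ = id.
-/

/-! ### Perron eigenvectors of irreducible non-negative matrices -/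

lemma mulVec_pos {ι : Type*} [Fintype ι] {B : Matrix ι ι ℝ} (hB : ∀ i j, 0 < B i j)
    {y : ι → ℝ} (hy : ∀ i, 0 ≤ y i) (hne : y ≠ 0) (i : ι) : 0 < B.mulVec y i := by
  obtain ⟨j, hj⟩ := Function.ne_iff.1 hne
  refine Finset.sum_pos' (fun l _ => mul_nonneg (hB i l).le (hy l)) ⟨j, Finset.mem_univ j, ?_⟩
  exact mul_pos (hB i j) (lt_of_le_of_ne (hy j) (Ne.symm hj))

lemma pow_entry_nonneg {ι : Type*} [Fintype ι] [DecidableEq ι] {A : Matrix ι ι ℝ}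
    (hA : ∀ i j, 0 ≤ A i j) (t : ℕ) (i j : ι) : 0 ≤ (A ^ t) i j := by
  induction t generalizing i j with
  | zero => simp only [pow_zero, Matrix.one_apply]; split_ifs <;> norm_num
  | succ t ih =>
    rw [pow_succ, Matrix.mul_apply]
    exact Finset.sum_nonneg fun l _ => mul_nonneg (ih i l) (hA l j)

/-- A sum of powers I + A + ⋯ + A^M works once M bounds the exponents needed for all pairs (i, j).
Such a B makes non-zero non-negative vectors strictly positive and, commuting with A, preserves
eigenvector relations. -/
lemma exists_commute_pos {ι : Type*} [Fintype ι] [DecidableEq ι] {A : Matrix ι ι ℝ}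
    (hA : ∀ i j, 0 ≤ A i j) (h : ∀ i j, ∃ t, 0 < (A ^ t) i j) :
    ∃ B : Matrix ι ι ℝ, Commute A B ∧ ∀ i j, 0 < B i j := by
  choose t ht using h
  let M := Finset.univ.sup fun i => Finset.univ.sup (t i)
  have hM : ∀ i j, t i j ≤ M := fun i j =>
    (Finset.le_sup (f := t i) (Finset.mem_univ j)).trans
      (Finset.le_sup (f := fun i => Finset.univ.sup (t i)) (Finset.mem_univ i))
  refine ⟨∑ s ∈ Finset.range (M + 1), A ^ s, ?_, fun i j => ?_⟩
  · exact Commute.sum_right _ _ _ fun s _ => (Commute.refl A).pow_right s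
  · rw [Matrix.sum_apply]
    exact Finset.sum_pos' (fun s _ => pow_entry_nonneg hA s i j)
      ⟨t i j, Finset.mem_range.2 (Nat.lt_succ_of_le (hM i j)), ht i j⟩

/-- Perron's theorem: an irreducible non-negative matrix has a positive eigenvector. -/
theorem exists_pos_eigenvector {ι : Type*} [Fintype ι] [DecidableEq ι] [Nonempty ι]
    {A : Matrix ι ι ℝ} (hA : ∀ i j, 0 ≤ A i j) (h : ∀ i j, ∃ t > 0, 0 < (A ^ t) i j) :
    ∃ (l : ℝ) (w : ι → ℝ), 0 < l ∧ (∀ i, 0 < w i) ∧ A.mulVec w = l • w := by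
  obtain ⟨B, hAB, hB⟩ :=
    exists_commute_pos hA fun i j => (h i j).imp fun _ ht => ht.2
  -- Collatz–Wielandt: maximise r over the pairs with r x ≤ A x, x in the simplex. A maximal r turns
  -- out to be an eigenvalue.
  let K : Set (ℝ × (ι → ℝ)) :=
    {p | 0 ≤ p.1 ∧ p.2 ∈ stdSimplex ℝ ι ∧ ∀ i, p.1 * p.2 i ≤ A.mulVec p.2 i}
  have hKc : IsCompact K := by
    refine IsCompact.of_isClosed_subset
      ((isCompact_Icc (a := (0 : ℝ)) (b := ∑ i, ∑ j, A i j)).prod (isCompact_stdSimplex ℝ ι)) ?_ ?_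
    · have hcl : IsClosed {p : ℝ × (ι → ℝ) | ∀ i, p.1 * p.2 i ≤ A.mulVec p.2 i} := ?_
      · exact (isClosed_le continuous_const continuous_fst).inter
          (((isClosed_stdSimplex ℝ ι).preimage continuous_snd).inter hcl)
      rw [Set.ofPred_forall]
      refine isClosed_iInter fun i => isClosed_le (by fun_prop) ?_
      exact (continuous_apply i).comp (Continuous.matrix_mulVec continuous_const continuous_snd)
    · rintro ⟨r, x⟩ ⟨h0, hx, hr⟩
      refine ⟨⟨h0, ?_⟩, hx⟩
      -- Summing r x_i ≤ (A x)_i over i bounds r by the sum of the entries of A, since ∑ x_i = 1 and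
      -- x_j ≤ 1.
      calc r = ∑ i, r * x i := by rw [← Finset.mul_sum, hx.2, mul_one]
        _ ≤ ∑ i, ∑ j, A i j * x j := Finset.sum_le_sum fun i _ => hr i
        _ ≤ ∑ i, ∑ j, A i j := Finset.sum_le_sum fun i _ => Finset.sum_le_sum fun j _ =>
          mul_le_of_le_one_right (hA i j) ((mem_Icc_of_mem_stdSimplex hx j).2)
  have hKne : K.Nonempty := by
    obtain ⟨i⟩ := ‹Nonempty ι›
    refine ⟨(0, Pi.single i 1), le_rfl, single_mem_stdSimplex ℝ i, fun j => ?_⟩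
    rw [zero_mul]
    exact Finset.sum_nonneg fun l _ =>
      mul_nonneg (hA j l) ((single_mem_stdSimplex ℝ i).1 l)
  obtain ⟨⟨r, x⟩, ⟨h0, hx, hr⟩, hmax⟩ := hKc.exists_isMaxOn hKne continuous_fst.continuousOn
  have hxne : x ≠ 0 := by
    rintro rfl
    have := hx.2
    simp at this
  have hz : ∀ i, 0 < B.mulVec x i := mulVec_pos hB hx.1 hxne
  have heig : A.mulVec x = r • x := by
    -- If A x - r x ≥ 0 is non-zero, B makes it strictly positive. Then A(Bx) ≥ (r + e) Bx with e
    -- the least coordinate ratio, and normalising Bx contradicts the maximality of r.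
    by_contra hne
    have hy : ∀ i, 0 < B.mulVec (A.mulVec x - r • x) i :=
      mulVec_pos hB (fun i => sub_nonneg.2 (hr i)) (sub_ne_zero.2 hne)
    obtain ⟨i₀, -, hi₀⟩ := Finset.exists_min_image Finset.univ
      (fun i => B.mulVec (A.mulVec x - r • x) i / B.mulVec x i) Finset.univ_nonempty
    set e := B.mulVec (A.mulVec x - r • x) i₀ / B.mulVec x i₀ with he
    have he0 : 0 < e := div_pos (hy i₀) (hz i₀)
    have hS : 0 < ∑ i, B.mulVec x i := Finset.sum_pos (fun i _ => hz i) Finset.univ_nonempty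
    have hmem : ((r + e, (∑ i, B.mulVec x i)⁻¹ • B.mulVec x) : ℝ × (ι → ℝ)) ∈ K := by
      refine ⟨by positivity, ⟨fun i => ?_, ?_⟩, fun i => ?_⟩
      · exact mul_nonneg (inv_nonneg.2 hS.le) (hz i).le
      · simp only [Pi.smul_apply, smul_eq_mul]
        rw [← Finset.mul_sum, inv_mul_cancel₀ hS.ne']
      · have h1 : e * B.mulVec x i ≤ B.mulVec (A.mulVec x - r • x) i :=
          (le_div_iff₀ (hz i)).1 (hi₀ i (Finset.mem_univ i))
        have h2 : B.mulVec (A.mulVec x - r • x) = A.mulVec (B.mulVec x) - r • B.mulVec x := by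
          rw [Matrix.mulVec_sub, Matrix.mulVec_smul, Matrix.mulVec_mulVec, Matrix.mulVec_mulVec,
            hAB.eq]
        rw [h2] at h1
        simp only [Matrix.mulVec_smul, Pi.smul_apply, smul_eq_mul, Pi.sub_apply] at h1 ⊢
        rw [mul_left_comm]
        exact mul_le_mul_of_nonneg_left (by linarith) (inv_nonneg.2 hS.le)
    have := hmax hmem
    simp only [Set.mem_ofPred_eq] at this
    linarith
  -- The maximiser x is only known to be non-negative; Bx is a strictly positive eigenvector for the
  -- same r.
  have heig' : A.mulVec (B.mulVec x) = r • B.mulVec x := by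
    rw [Matrix.mulVec_mulVec, hAB.eq, ← Matrix.mulVec_mulVec, heig, Matrix.mulVec_smul]
  refine ⟨r, B.mulVec x, lt_of_le_of_ne h0 ?_, hz, heig'⟩
  -- For r = 0 every A^t with t > 0 kills the positive vector Bx, which is impossible when A^t has a
  -- positive diagonal entry.
  rintro rfl
  obtain ⟨i⟩ := ‹Nonempty ι›
  obtain ⟨t, ht, hpos⟩ := h i i
  have h1 : (A ^ t).mulVec (B.mulVec x) i = 0 := by
    obtain ⟨s, rfl⟩ := Nat.exists_eq_add_of_lt ht
    rw [zero_add, pow_succ, ← Matrix.mulVec_mulVec, heig', zero_smul, Matrix.mulVec_zero]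
    rfl
  refine absurd h1 (Finset.sum_pos' (fun l _ => ?_) ⟨i, Finset.mem_univ i, ?_⟩).ne'
  · exact mul_nonneg (pow_entry_nonneg hA t i l) (hz l).le
  · exact mul_pos hpos (hz i)

/-! ### Simplicity of the eventual range -/

open Polynomial in
-- Reversal is multiplicative over a field and preserves the degree of polynomials with non-zero
-- constant term, so a factorization of q reverses to one of its reversal, with units coming only
-- from units. This carries irreducibility from det(1 - tA), the reversed characteristic polynomial,
-- to the part of the characteristic polynomial prime to X.
lemma irreducible_of_reverse {K : Type*} [Field K] {q : K[X]} (h0 : q.coeff 0 ≠ 0)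
    (h : Irreducible q.reverse) : Irreducible q := by
  have hq : q ≠ 0 := by rintro rfl; simp at h0
  have hdeg : ∀ p : K[X], p.coeff 0 ≠ 0 → p.reverse.natDegree = p.natDegree := fun p hp => by
    rw [reverse_natDegree, natTrailingDegree_eq_zero.2 (Or.inr hp), Nat.sub_zero]
  have hunit : ∀ p : K[X], p.coeff 0 ≠ 0 → IsUnit p.reverse → IsUnit p := fun p hp hu => by
    have hd := hdeg p hp
    rw [natDegree_eq_zero_of_isUnit hu] at hd
    rw [eq_C_of_natDegree_eq_zero hd.symm]
    exact isUnit_C.2 (isUnit_iff_ne_zero.2 hp)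
  refine ⟨fun hu => h.not_isUnit ?_, fun a b hab => ?_⟩
  · obtain ⟨c, hc, rfl⟩ := isUnit_iff.1 hu
    rw [reverse_C]
    exact hu
  · have hab0 : a.coeff 0 * b.coeff 0 ≠ 0 := by rwa [← mul_coeff_zero, ← hab]
    rw [hab, reverse_mul_of_domain] at h
    exact (h.isUnit_or_isUnit rfl).imp (hunit a (left_ne_zero_of_mul hab0))
      (hunit b (right_ne_zero_of_mul hab0))

/-- The action of `A` on rational row vectors. -/
abbrev rowMap (A : Matrix (Fin k) (Fin k) ℕ) : Module.End ℚ (Fin k → ℚ) :=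
  (ratMatrix A).vecMulLinear

lemma charpoly_rowMap : (rowMap A).charpoly = (ratMatrix A).charpoly := by
  have : rowMap A = (ratMatrix A).transpose.toLin' := by
    refine LinearMap.ext fun x => ?_
    rw [Matrix.vecMulLinear_apply, Matrix.toLin'_apply, Matrix.mulVec_transpose]
  rw [this, Matrix.charpoly_toLin', Matrix.charpoly_transpose]

/-- Rank–nullity for A^k: its kernel is the generalized eigenspace of 0, whose dimension is the
multiplicity of the root 0 of the characteristic polynomial. -/
lemma finrank_eventualRange_add :
    Module.finrank ℚ (eventualRange A) + (ratMatrix A).charpoly.natTrailingDegree = k := by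
  have h1 := LinearMap.finrank_range_add_finrank_ker (rowMap A ^ k)
  rw [Module.finrank_fin_fun] at h1
  rw [← charpoly_rowMap, ← LinearMap.finrank_maxGenEigenspace_zero_eq,
    Module.End.maxGenEigenspace_eq_genEigenspace_finrank, Module.finrank_fin_fun,
    Module.End.genEigenspace_nat, zero_smul, sub_zero]
  rw [vecMulLinear_pow] at h1 ⊢
  exact h1

/-- The eventual range is a simple `ℚ[A]`-module if `det (1 - tA)` is irreducible. -/
theorem eventualRange_le_of_invariant
    (hdet : Irreducible (ratMatrix A).charpolyRev) {W : Submodule ℚ (Fin k → ℚ)}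
    (hW : W ≤ eventualRange A) (hinv : ∀ x ∈ W, Matrix.vecMul x (ratMatrix A) ∈ W)
    (hne : W ≠ ⊥) : eventualRange A ≤ W := by
  obtain ⟨x, hxW, hx0⟩ := W.ne_bot_iff.1 hne
  have hc0 : (ratMatrix A).charpoly ≠ 0 := (Matrix.charpoly_monic _).ne_zero
  -- Write the characteristic polynomial as X^j q with q(0) ≠ 0. Reversal forgets X^j, so q inherits
  -- irreducibility, and deg q = dim R(A).
  obtain ⟨q, hq, hqX⟩ := Polynomial.exists_eq_pow_rootMultiplicity_mul_and_not_dvd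
    (ratMatrix A).charpoly hc0 0
  rw [Polynomial.rootMultiplicity_eq_natTrailingDegree', Polynomial.C_0, sub_zero] at hq
  rw [Polynomial.C_0, sub_zero, Polynomial.X_dvd_iff] at hqX
  set j := (ratMatrix A).charpoly.natTrailingDegree with hj
  have hq0 : q ≠ 0 := by rintro rfl; simp at hqX
  have hqirr : Irreducible q := by
    refine irreducible_of_reverse hqX ?_
    rwa [← Polynomial.reverse_X_pow_mul q j, ← hq, Matrix.reverse_charpoly]
  have hqdeg : q.natDegree = Module.finrank ℚ (eventualRange A) := by
    have h1 := congrArg Polynomial.natDegree hq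
    rw [Matrix.charpoly_natDegree_eq_dim, Fintype.card_fin,
      Polynomial.natDegree_mul (pow_ne_zero _ Polynomial.X_ne_zero) hq0,
      Polynomial.natDegree_X_pow] at h1
    have h2 := finrank_eventualRange_add (A := A)
    omega
  have hmem : ∀ p : Polynomial ℚ, ∀ y ∈ W, Polynomial.aeval (rowMap A) p y ∈ W := by
    intro p y hy
    induction p using Polynomial.induction_on' with
    | add p r hp hr => rw [map_add]; exact W.add_mem hp hr
    | monomial n c =>
      rw [Polynomial.aeval_monomial, Module.End.mul_apply, Module.algebraMap_end_apply]
      refine W.smul_mem c ?_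
      induction n with
      | zero => exact hy
      | succ n ih =>
        rw [pow_succ', Module.End.mul_apply]
        exact hinv _ ih
  -- Cayley–Hamilton gives A^j q(A) x = 0, and A is injective on R(A), so A^j can be cancelled.
  have hkill : Polynomial.aeval (rowMap A) q x = 0 := by
    have h1 : (rowMap A ^ j) (Polynomial.aeval (rowMap A) q x) = 0 := by
      have := LinearMap.aeval_self_charpoly (rowMap A)
      rw [charpoly_rowMap, hq, map_mul, map_pow, Polynomial.aeval_X] at this
      rw [← Module.End.mul_apply, this, LinearMap.zero_apply]
    have h2 : ∀ n : ℕ, ∀ y ∈ eventualRange A, (rowMap A ^ n) y = 0 → y = 0 := by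
      intro n
      induction n with
      | zero => exact fun y _ hy => hy
      | succ n ih =>
        intro y hy h
        rw [pow_succ, Module.End.mul_apply] at h
        exact eq_zero_of_vecMul_eq_zero hy (ih _ (vecMul_mem_eventualRange hy) h)
    exact h2 j _ (hW (hmem q x hxW)) h1
  -- A non-zero p of smaller degree is coprime to q; if p(A) also killed x, Bézout would give x = 0.
  have hinj : ∀ p : Polynomial ℚ, p.degree < q.natDegree →
      Polynomial.aeval (rowMap A) p x = 0 → p = 0 := by
    intro p hp hpx
    by_contra hp0
    have hco : IsCoprime q p := by
      refine (hqirr.coprime_iff_not_dvd).2 fun hd => ?_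
      have := Polynomial.degree_le_of_dvd hd hp0
      rw [Polynomial.degree_eq_natDegree hq0] at this
      exact absurd hp (not_lt.2 this)
    obtain ⟨a, b, hab⟩ := hco
    have := congrArg (fun r => Polynomial.aeval (rowMap A) r x) hab
    simp only [map_add, map_mul, map_one, LinearMap.add_apply, Module.End.mul_apply, hkill, hpx,
      map_zero, add_zero, Module.End.one_apply] at this
    exact hx0 this.symm
  -- The map p ↦ p(A) x embeds the polynomials of degree below deg q into W, so dim W ≥ dim R(A).
  let F : Polynomial.degreeLT ℚ q.natDegree →ₗ[ℚ] W :=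
    { toFun := fun p => ⟨Polynomial.aeval (rowMap A) p.1 x, hmem p.1 x hxW⟩
      map_add' := fun p r => Subtype.ext (by simp)
      map_smul' := fun c p => Subtype.ext (by simp) }
  have hF : Function.Injective F := by
    rw [← LinearMap.ker_eq_bot, LinearMap.ker_eq_bot']
    intro p hp
    exact Subtype.ext (hinj p.1 (Polynomial.mem_degreeLT.1 p.2) (congrArg Subtype.val hp))
  have hle := LinearMap.finrank_le_finrank_of_injective hF
  rw [(Polynomial.degreeLTEquiv ℚ q.natDegree).finrank_eq, Module.finrank_fin_fun, hqdeg] at hle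
  exact (Submodule.eq_of_le_of_finrank_le hW hle).ge

/-! ### The Perron functional on the dimension group -/

/-- The pairing of rational row vectors with a real column vector. -/
noncomputable def pairing (w : Fin k → ℝ) : (Fin k → ℚ) →ₗ[ℚ] ℝ where
  toFun x := ∑ i, (x i : ℝ) * w i
  map_add' x y := by simp [add_mul, Finset.sum_add_distrib]
  map_smul' c x := by simp [Finset.mul_sum, mul_assoc, Rat.smul_def]

lemma pairing_apply (w : Fin k → ℝ) (x : Fin k → ℚ) : pairing w x = ∑ i, (x i : ℝ) * w i := rfl

/-- `w` is a positive right eigenvector of `A` with positive eigenvalue `l`. -/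
structure IsPerron (A : Matrix (Fin k) (Fin k) ℕ) (l : ℝ) (w : Fin k → ℝ) : Prop where
  eigenvalue_pos : 0 < l
  pos : ∀ i, 0 < w i
  mulVec_eq : (A.map (Nat.cast : ℕ → ℝ)).mulVec w = l • w

lemma PosIrreducible.exists_isPerron (h : PosIrreducible A) (hk : 0 < k) :
    ∃ l w, IsPerron A l w := by
  have : Nonempty (Fin k) := ⟨⟨0, hk⟩⟩
  obtain ⟨l, w, hl, hw, he⟩ := exists_pos_eigenvector (A := A.map (Nat.cast : ℕ → ℝ))
    (fun i j => by simp) fun i j => by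
      obtain ⟨t, ht, hp⟩ := h.exists_pow_pos i j
      refine ⟨t, ht, ?_⟩
      rw [show (A.map (Nat.cast : ℕ → ℝ)) ^ t = (A ^ t).map (Nat.cast : ℕ → ℝ) from
        (map_pow (Nat.castRingHom ℝ).mapMatrix A t).symm]
      simpa using hp
  exact ⟨l, w, hl, hw, he⟩

namespace IsPerron

variable {l : ℝ} {w : Fin k → ℝ}

lemma pairing_vecMul (hw : IsPerron A l w) (x : Fin k → ℚ) :
    pairing w (Matrix.vecMul x (ratMatrix A)) = l * pairing w x := by
  have h1 : ∀ y : Fin k → ℚ, pairing w y = (fun i => (y i : ℝ)) ⬝ᵥ w := fun y => rfl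
  have h2 : (fun i => ((Matrix.vecMul x (ratMatrix A) i : ℚ) : ℝ)) =
      Matrix.vecMul (fun i => (x i : ℝ)) (A.map (Nat.cast : ℕ → ℝ)) := by
    funext i
    simp [Matrix.vecMul, dotProduct]
  rw [h1, h2, ← Matrix.dotProduct_mulVec, hw.mulVec_eq, dotProduct_smul, h1, smul_eq_mul]

lemma pairing_dimShift_zpow (hw : IsPerron A l w) (n : ℤ) (x : dimGroup A) :
    pairing w ((dimShift A ^ n) x).1 = l ^ n * pairing w x.1 := by
  have h1 : ∀ x, pairing w (dimShift A x).1 = l * pairing w x.1 := fun x => by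
    rw [coe_dimShift, hw.pairing_vecMul]
  have hl := hw.eigenvalue_pos.ne'
  induction n generalizing x with
  | zero => simp
  | succ n ih =>
    rw [zpow_add_one, LinearEquiv.mul_apply, ih, h1, zpow_add_one₀ hl, mul_assoc]
  | pred n ih =>
    have h2 := h1 ((dimShift A ^ (-(n : ℤ) - 1)) x)
    rw [← LinearEquiv.mul_apply, ← zpow_one_add, add_sub_cancel, ih] at h2
    rw [zpow_sub_one₀ hl]
    field_simp
    linarith

lemma pairing_ofVec (hw : IsPerron A l w) (v : Fin k → ℕ) :
    pairing w (ofVec A v).1 = l ^ k * ∑ i, (v i : ℝ) * w i := by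
  have h1 : ∀ (n : ℕ) (x : Fin k → ℚ),
      pairing w (Matrix.vecMul x (ratMatrix A ^ n)) = l ^ n * pairing w x := by
    intro n x
    induction n with
    | zero => simp
    | succ n ih =>
      rw [pow_succ, ← Matrix.vecMul_vecMul, hw.pairing_vecMul, ih, pow_succ]
      ring
  rw [coe_ofVec, h1, pairing_apply]
  simp

/-- The factor l^k from v A^k cancels against δ_A^(-k) in θ. What remains is a weight of beams that
is monotone in the counts, the link between the dimension group and counting rays. -/
lemma pairing_thetaAt (hw : IsPerron A l w) (U : Set (EdgeShift A)) (n : ℤ) :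
    pairing w (thetaAt U n).1 = l ^ (-n) * ∑ J, (endCount U n J : ℝ) * w J := by
  rw [thetaAt, hw.pairing_dimShift_zpow, hw.pairing_ofVec, ← mul_assoc, ← zpow_natCast,
    ← zpow_add₀ hw.eigenvalue_pos.ne']
  congr 2
  ring

lemma pairing_ofVec_one_pos (hw : IsPerron A l w) (hk : 0 < k) :
    0 < pairing w (ofVec A 1).1 := by
  rw [hw.pairing_ofVec]
  refine mul_pos (pow_pos hw.eigenvalue_pos _) ?_
  have : Nonempty (Fin k) := ⟨⟨0, hk⟩⟩
  exact Finset.sum_pos (fun i _ => by simpa using hw.pos i) Finset.univ_nonempty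

lemma pairing_nonneg (hw : IsPerron A l w) {x : dimGroup A} (hx : x ∈ dimCone A) :
    0 ≤ pairing w x.1 := by
  obtain ⟨m, u, hu⟩ := hx
  have h1 := hw.pairing_dimShift_zpow m x
  rw [zpow_natCast, coe_dimShift_pow, hu, pairing_apply] at h1
  have h2 : 0 ≤ ∑ i, (((u i : ℕ) : ℚ) : ℝ) * w i :=
    Finset.sum_nonneg fun i _ => mul_nonneg (by positivity) (hw.pos i).le
  rw [h1] at h2
  exact nonneg_of_mul_nonneg_right h2 (zpow_pos hw.eigenvalue_pos _)

/-- If `det (1 - tA)` is irreducible, the Perron functional is injective on the eventual range. -/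
lemma eq_zero_of_pairing_eq_zero (hw : IsPerron A l w)
    (hdet : Irreducible (ratMatrix A).charpolyRev) (hk : 0 < k) {x : Fin k → ℚ}
    (hx : x ∈ eventualRange A) (h0 : pairing w x = 0) : x = 0 := by
  by_contra hne
  -- The kernel of τ in R(A) is A-invariant. If it were non-zero it would be all of R(A), but τ is
  -- positive on (1, …, 1) A^k.
  have hle := eventualRange_le_of_invariant hdet
    (W := eventualRange A ⊓ LinearMap.ker (pairing w)) inf_le_left ?_ ?_
  · have : pairing w (ofVec A 1).1 = 0 := (hle (ofVec A 1).2.1).2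
    exact (hw.pairing_ofVec_one_pos hk).ne' this
  · rintro y ⟨hy, hy0⟩
    refine ⟨vecMul_mem_eventualRange hy, ?_⟩
    rw [SetLike.mem_coe, LinearMap.mem_ker] at hy0 ⊢
    rw [hw.pairing_vecMul, hy0, mul_zero]
  · exact (Submodule.ne_bot_iff _).2 ⟨x, ⟨hx, h0⟩, hne⟩

/-- An automorphism commuting with `δ_A` scales the Perron functional. -/
lemma pairing_mul_comm (hw : IsPerron A l w)
    (hdet : Irreducible (ratMatrix A).charpolyRev) {Φ : GroupAut (dimGroup A)}
    (hΦ : Φ * dimShift A = dimShift A * Φ) {x₀ : dimGroup A} (hx₀ : x₀ ≠ 0) (x : dimGroup A) :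
    pairing w (Φ x).1 * pairing w x₀.1 = pairing w x.1 * pairing w (Φ x₀).1 := by
  -- The cross-multiplied form puts x₀ in H by commutativity alone. As Φ lives only on 𝒢_A and not
  -- on R(A), simplicity is applied to the rational span of H, and membership is brought back to H
  -- by clearing denominators.
  let H : Set (dimGroup A) :=
    {z | pairing w (Φ z).1 * pairing w x₀.1 = pairing w z.1 * pairing w (Φ x₀).1}
  have hadd : ∀ y ∈ H, ∀ z ∈ H, y + z ∈ H := by
    intro y hy z hz
    simp only [H, Set.mem_ofPred_eq, map_add, AddSubgroup.coe_add, add_mul] at hy hz ⊢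
    rw [hy, hz]
  -- The identity is homogeneous in z and ℝ is torsion-free, so H is closed under division by
  -- non-zero integers as well as under multiples.
  have hsmul : ∀ n : ℤ, ∀ z, (n • z ∈ H ↔ n = 0 ∨ z ∈ H) := by
    intro n z
    simp only [H, Set.mem_ofPred_eq, map_zsmul, AddSubgroup.coe_zsmul, smul_mul_assoc]
    rw [← sub_eq_zero, ← smul_sub, smul_eq_zero, sub_eq_zero]
  have hshift : ∀ z ∈ H, dimShift A z ∈ H := by
    intro z hz
    simp only [H, Set.mem_ofPred_eq] at hz ⊢
    rw [← LinearEquiv.mul_apply, hΦ, LinearEquiv.mul_apply, coe_dimShift, coe_dimShift,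
      hw.pairing_vecMul, hw.pairing_vecMul, mul_assoc, hz, mul_assoc]
  let W : Submodule ℚ (Fin k → ℚ) := Submodule.span ℚ (Subtype.val '' H)
  have hle : eventualRange A ≤ W := by
    refine eventualRange_le_of_invariant hdet ?_ ?_ ?_
    · rw [Submodule.span_le]
      rintro _ ⟨z, -, rfl⟩
      exact z.2.1
    · intro y hy
      have : W ≤ W.comap (rowMap A) := by
        rw [Submodule.span_le]
        rintro _ ⟨z, hz, rfl⟩
        exact Submodule.subset_span ⟨_, hshift z hz, rfl⟩
      exact this hy
    · exact (Submodule.ne_bot_iff _).2 ⟨x₀.1, Submodule.subset_span ⟨x₀, mul_comm _ _, rfl⟩,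
        fun h => hx₀ (Subtype.ext h)⟩
  have key : ∀ y ∈ W, ∃ n : ℤ, n ≠ 0 ∧ ∃ z ∈ H, z.1 = n • y := by
    intro y hy
    induction hy using Submodule.span_induction with
    | mem y hy =>
      obtain ⟨z, hz, rfl⟩ := hy
      exact ⟨1, one_ne_zero, z, hz, (one_zsmul _).symm⟩
    | zero => exact ⟨1, one_ne_zero, 0, by simp [H], by simp⟩
    | add y y' _ _ hy hy' =>
      obtain ⟨n, hn, z, hz, e⟩ := hy
      obtain ⟨n', hn', z', hz', e'⟩ := hy'
      refine ⟨n * n', mul_ne_zero hn hn', n' • z + n • z', hadd _ ((hsmul _ _).2 (Or.inr hz)) _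
        ((hsmul _ _).2 (Or.inr hz')), ?_⟩
      rw [AddSubgroup.coe_add, AddSubgroup.coe_zsmul, AddSubgroup.coe_zsmul, e, e', smul_add,
        mul_smul, mul_smul, smul_comm n' n y]
    | smul c y _ hy =>
      obtain ⟨n, hn, z, hz, e⟩ := hy
      -- If n y comes from z in H, then n · den(c) · (c y) = num(c) · (n y) comes from num(c) z.
      refine ⟨n * c.den, mul_ne_zero hn (by exact_mod_cast c.den_nz), c.num • z,
        (hsmul _ _).2 (Or.inr hz), ?_⟩
      rw [AddSubgroup.coe_zsmul, e]
      ext i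
      simp only [Pi.smul_apply, zsmul_eq_mul, smul_eq_mul, Int.cast_mul, Int.cast_natCast,
        Pi.mul_apply, Pi.intCast_apply]
      have := Rat.mul_den_eq_num c
      linear_combination (-(n : ℚ) * y i) * this
  obtain ⟨n, hn, z, hz, e⟩ := key x.1 (hle x.2.1)
  have : z = n • x := Subtype.ext e
  exact ((hsmul n x).1 (this ▸ hz)).resolve_left hn

/-- An automorphism of the dimension triple scales the Perron functional by a positive factor. -/
lemma exists_scale (hw : IsPerron A l w) (hdet : Irreducible (ratMatrix A).charpolyRev)
    (hk : 0 < k) {Φ : GroupAut (dimGroup A)} (hΦ : Φ ∈ DimAut A) :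
    ∃ s : ℝ, 0 < s ∧ ∀ x : dimGroup A, pairing w (Φ x).1 = s * pairing w x.1 := by
  have h0 := hw.pairing_ofVec_one_pos hk
  have hne : ofVec A 1 ≠ 0 := by
    intro h
    rw [h] at h0
    simp at h0
  have hcone : Φ (ofVec A 1) ∈ dimCone A := by
    rw [← SetLike.mem_coe, ← hΦ.1]
    exact ⟨_, ⟨0, Matrix.vecMul 1 (A ^ k), by
      rw [cast_vecMul, pow_zero, Matrix.vecMul_one, coe_ofVec]⟩, rfl⟩
  -- Non-negativity comes from preservation of the cone; a zero value would force Φ(ofVec A 1) = 0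
  -- by injectivity of τ. The scaling factor is the ratio of the two values at `ofVec A 1`.
  have hpos : 0 < pairing w (Φ (ofVec A 1)).1 := by
    refine lt_of_le_of_ne (hw.pairing_nonneg hcone) fun h => hne ?_
    have := hw.eq_zero_of_pairing_eq_zero hdet hk (Φ (ofVec A 1)).2.1 h.symm
    exact (map_eq_zero_iff Φ Φ.injective).1 (Subtype.ext this)
  refine ⟨_, div_pos hpos h0, fun x => ?_⟩
  have := hw.pairing_mul_comm hdet hΦ.2 hne x
  field_simp
  linarith

end IsPerron

/-! ### Separated orbit segments and entropy -/

/-- θ does not depend on the level at which a beam is read, so n and m may be any levels valid for U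
and for φ(U). -/
lemma dimAut_thetaAt (h : PosIrreducible A) (φ : AutShift A) {U : Set (EdgeShift A)} {m n : ℤ}
    (hU : IsBeam U n) (hV : IsBeam (φ.1 '' U) m) :
    dimAut h φ (thetaAt U n) = thetaAt (φ.1 '' U) m := by
  let B : Beam A := ⟨U, n, hU⟩
  have h1 : thetaAt U n = theta h (Algebra.GrothendieckAddGroup.of (KriegerCone.mk h B)) :=
    (KriegerCone.theta_mk (U := B) hU).symm.trans (theta_of h _).symm
  rw [h1, dimAut_theta, KriegerGroup.map_of, theta_of, KriegerCone.map_mk]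
  exact KriegerCone.theta_mk (U := B.map φ) hV

lemma AutShift.mul_apply (φ ψ : AutShift A) (x : EdgeShift A) :
    (φ * ψ).1 x = φ.1 (ψ.1 x) := rfl

lemma AutShift.iterate_eq_pow (φ : AutShift A) (n : ℕ) (x : EdgeShift A) :
    φ.1^[n] x = (φ ^ n).1 x := by
  induction n generalizing x with
  | zero => rfl
  | succ n ih => rw [Function.iterate_succ_apply, ih, pow_succ, AutShift.mul_apply]

/-- Pairs of points that agree on the coordinates `-N, …, N`. -/
def window (A : Matrix (Fin k) (Fin k) ℕ) (N : ℕ) : SetRel (EdgeShift A) (EdgeShift A) :=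
  {p | ∀ i : ℤ, -N ≤ i → i ≤ N → p.1.1 i = p.2.1 i}

lemma window_mem_uniformity (N : ℕ) : window A N ∈ uniformity (EdgeShift A) := by
  have h1 : ∀ i : ℤ, {p : EdgeShift A × EdgeShift A | p.1.1 i = p.2.1 i} ∈
      uniformity (EdgeShift A) := by
    intro i
    have hc : UniformContinuous fun x : EdgeShift A => x.1 i :=
      (Pi.uniformContinuous_proj _ i).comp uniformContinuous_subtype_val
    exact hc (DiscreteUniformity.relId_mem_uniformity (Edge A))
  have h2 : (⋂ i ∈ Set.Icc (-N : ℤ) N, {p : EdgeShift A × EdgeShift A | p.1.1 i = p.2.1 i}) ∈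
      uniformity (EdgeShift A) :=
    (Filter.biInter_mem (Set.finite_Icc _ _)).2 fun i _ => h1 i
  refine Filter.mem_of_superset h2 fun p hp i h3 h4 => ?_
  exact Set.mem_iInter₂.1 hp i ⟨h3, h4⟩

/-- The orbit segments of length `n` of distinct points of `t` are distinguished by the
coordinates `-N, …, N`. -/
def IsSeparated (φ : AutShift A) (N n : ℕ) (t : Set (EdgeShift A)) : Prop :=
  ∀ u ∈ t, ∀ v ∈ t, (∀ j : ℕ, j < n → ((φ ^ j).1 u, (φ ^ j).1 v) ∈ window A N) → u = v

/-- Agreement on a window is an equivalence relation: a point common to the dynamical balls of u and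
v makes u and v agree along the whole segment. Hence the balls are disjoint without passing to a
smaller entourage. -/
lemma IsSeparated.isDynNetIn {φ : AutShift A} {N n : ℕ} {t : Set (EdgeShift A)}
    (ht : IsSeparated φ N n t) : Dynamics.IsDynNetIn φ.1 univ (window A N) n t := by
  refine ⟨subset_univ _, fun u hu v hv huv => Set.disjoint_left.2 fun z hz hz' => huv ?_⟩
  refine ht u hu v hv fun j hj i h1 h2 => ?_
  have e1 := Dynamics.mem_ball_dynEntourage.1 hz j hj i h1 h2
  have e2 := Dynamics.mem_ball_dynEntourage.1 hz' j hj i h1 h2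
  simp only [AutShift.iterate_eq_pow] at e1 e2
  exact e1.trans e2.symm

/-- The φ⁻¹-segment of u, read backwards, is the φ-segment of φ^(-(n-1)) u; time j for φ⁻¹ is time n
- 1 - j for φ. -/
lemma IsSeparated.image_inv {φ : AutShift A} {N n : ℕ} {t : Set (EdgeShift A)}
    (ht : IsSeparated φ⁻¹ N n t) : IsSeparated φ N n ((φ⁻¹ ^ (n - 1)).1 '' t) := by
  rintro _ ⟨u, hu, rfl⟩ _ ⟨v, hv, rfl⟩ h
  refine congrArg _ (ht u hu v hv fun j hj => ?_)
  have h1 := h (n - 1 - j) (by omega)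
  rw [← AutShift.mul_apply, ← AutShift.mul_apply] at h1
  have e : φ ^ (n - 1 - j) * φ⁻¹ ^ (n - 1) = φ⁻¹ ^ j := by
    obtain ⟨d, hd⟩ : ∃ d, n - 1 = d + j := ⟨n - 1 - j, by omega⟩
    rw [hd, Nat.add_sub_cancel, pow_add, ← mul_assoc, inv_pow, mul_inv_cancel, one_mul]
  rwa [e] at h1

/-- Exponentially many separated orbit segments force positive entropy. -/
lemma topEntropy_pos_of_isSeparated {φ : AutShift A} {N : ℕ} {s c : ℝ} (hs : 1 < s) (hc : 0 < c)
    (h : ∀ n : ℕ, ∃ t : Finset (EdgeShift A), IsSeparated φ N n t ∧ s ^ n * c ≤ t.card) :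
    0 < topEntropy φ.1 := by
  have h1 : ∀ n : ℕ, ENNReal.ofReal c * ENNReal.ofReal s ^ n ≤
      ((Dynamics.netMaxcard φ.1 univ (window A N) n : ℕ∞) : ENNReal) := by
    intro n
    obtain ⟨t, ht, hle⟩ := h n
    calc ENNReal.ofReal c * ENNReal.ofReal s ^ n = ENNReal.ofReal (s ^ n * c) := by
          rw [← ENNReal.ofReal_pow (by linarith), ← ENNReal.ofReal_mul hc.le, mul_comm]
      _ ≤ ENNReal.ofReal t.card := ENNReal.ofReal_le_ofReal hle
      _ = ((t.card : ℕ∞) : ENNReal) := by simp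
      _ ≤ _ := ENat.toENNReal_mono ht.isDynNetIn.card_le_netMaxcard
  -- The growth rate of c s^n is log s, whatever the positive constant c. The single entourage given
  -- by N suffices, because its net entropy bounds the topological entropy from below.
  have h2 : ENNReal.log (ENNReal.ofReal s) ≤
      Dynamics.netEntropyEntourage φ.1 univ (window A N) := by
    rw [← ExpGrowth.expGrowthSup_pow]
    exact ExpGrowth.expGrowthSup_of_eventually_ge (by simpa using hc) (Eventually.of_forall h1)
  refine lt_of_lt_of_le ?_ (h2.trans
    (Dynamics.netEntropyEntourage_le_coverEntropy _ _ (window_mem_uniformity N)))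
  rw [← ENNReal.log_one]
  exact ENNReal.log_strictMono (by simpa using hs)

/-! ### Growth of the images of a ray -/

/-- Points in a common ray whose orbit segments are not distinguished by a coding window stay in
a common ray. -/
lemma ray_pow_eq {φ : AutShift A} {N : ℕ} (hN : ∀ (x y : EdgeShift A) (m : ℤ),
    (∀ i : ℤ, m - N ≤ i → i ≤ m + N → x.1 i = y.1 i) → (φ.1 x).1 m = (φ.1 y).1 m)
    {u v : EdgeShift A} (huv : ray u 0 = ray v 0) {n : ℕ}
    (h : ∀ j : ℕ, j < n → ((φ ^ j).1 u, (φ ^ j).1 v) ∈ window A N) :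
    ray ((φ ^ n).1 u) 0 = ray ((φ ^ n).1 v) 0 := by
  induction n with
  | zero => exact huv
  | succ n ih =>
    have h1 := ray_eq_iff.1 (ih fun j hj => h j (by omega))
    refine ray_eq_iff.2 fun m hm => ?_
    rw [pow_succ', AutShift.mul_apply, AutShift.mul_apply]
    refine hN _ _ _ fun i h2 h3 => ?_
    -- Coordinates of the next image at m ≤ 0 depend on coordinates up to N: those ≤ 0 agree by
    -- induction, those in 1, …, N by the window at time n.
    by_cases hi : i ≤ 0
    · exact h1 i hi
    · exact h n (by omega) i (by omega) (by omega)

/-- V is contained in the union V' of the 0-rays it meets, so its weight is at most that of V', and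
at level 0 each state is the end of at most as many rays as there are 0-rays in V'. The set t picks
one point of V in each of these 0-rays. -/
lemma IsPerron.pairing_thetaAt_le {l : ℝ} {w : Fin k → ℝ} (hw : IsPerron A l w)
    (h : PosIrreducible A) {V : Set (EdgeShift A)} {m : ℕ} (hV : IsBeam V m) :
    ∃ t : Finset (EdgeShift A), ↑t ⊆ V ∧ InjOn (fun y => ray y 0) (t : Set (EdgeShift A)) ∧
      pairing w (thetaAt V m).1 ≤ t.card * ∑ J, w J := by
  have hfin : ((fun y => ray y 0) '' V).Finite := by
    obtain ⟨t, -, ht, hte⟩ := exists_finite_reps (isBeam_iff.1 hV).2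
    refine (ht.image fun y => ray y 0).subset ?_
    rintro _ ⟨y, hy, rfl⟩
    obtain ⟨z, hz, hzy⟩ : ray y m ∈ (fun x => ray x m) '' t := hte ▸ ⟨y, hy, rfl⟩
    exact ⟨z, hz, ray_eq_iff.2 fun i hi => ray_eq_iff.1 hzy i (by omega)⟩
  obtain ⟨T, hTV, hT⟩ := exists_subset_bijOn V fun y => ray y 0
  have hTfin : T.Finite := Set.Finite.of_finite_image (by rwa [hT.image_eq]) hT.injOn
  obtain ⟨t, rfl⟩ := hTfin.exists_finset_coe
  refine ⟨t, hTV, hT.injOn, ?_⟩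
  let V' : Set (EdgeShift A) := ⋃ y ∈ (t : Set (EdgeShift A)), ray y 0
  have hV' : IsBeam V' 0 := ⟨_, hTfin, rfl⟩
  have hsub : V ⊆ V' := by
    intro y hy
    obtain ⟨z, hz, hzy⟩ := hT.surjOn ⟨y, hy, rfl⟩
    exact mem_iUnion₂.2 ⟨z, hz, ray_eq_iff.1 hzy.symm⟩
  have h1 : ∀ J, endCount V m J ≤ endCount V' m J := fun J => by
    refine Set.ncard_le_ncard ?_ (endRays_finite (hV'.mono (by omega)) J)
    rintro _ ⟨y, hy, hJ, rfl⟩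
    exact ⟨y, hsub hy, hJ, rfl⟩
  have h2 : ∀ J, endCount V' 0 J ≤ t.card := fun J => by
    rw [← Set.ncard_coe_finset]
    refine le_trans (Set.ncard_le_ncard ?_ (hTfin.image fun y => ray y 0))
      (Set.ncard_image_le hTfin)
    rintro _ ⟨y, hy, -, rfl⟩
    obtain ⟨z, hz, hyz⟩ := mem_iUnion₂.1 hy
    exact ⟨z, hz, (ray_eq_iff.2 hyz).symm⟩
  -- V and V' are compared at level m, where both are beams; then the weight of V' is evaluated at
  -- level 0.
  calc pairing w (thetaAt V m).1 ≤ pairing w (thetaAt V' m).1 := by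
        rw [hw.pairing_thetaAt, hw.pairing_thetaAt]
        refine mul_le_mul_of_nonneg_left (Finset.sum_le_sum fun J _ => ?_)
          (zpow_pos hw.eigenvalue_pos _).le
        exact mul_le_mul_of_nonneg_right (by exact_mod_cast h1 J) (hw.pos J).le
    _ = pairing w (thetaAt V' 0).1 := by rw [thetaAt_mono h hV' (by omega : (0 : ℤ) ≤ m)]
    _ ≤ t.card * ∑ J, w J := by
        rw [hw.pairing_thetaAt, neg_zero, zpow_zero, one_mul, Finset.mul_sum]
        exact Finset.sum_le_sum fun J _ =>
          mul_le_mul_of_nonneg_right (by exact_mod_cast h2 J) (hw.pos J).le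

/-- If `φ` scales the Perron functional by `s`, then orbit segments of `φ` of length `n` can be
separated in about `s ^ n` ways. -/
lemma IsPerron.exists_isSeparated {l : ℝ} {w : Fin k → ℝ} (hw : IsPerron A l w)
    (h : PosIrreducible A) {φ : AutShift A} {s : ℝ}
    (hs : ∀ x : dimGroup A, pairing w (dimAut h φ x).1 = s * pairing w x.1) {N : ℕ}
    (hN : ∀ (x y : EdgeShift A) (m : ℤ),
    (∀ i : ℤ, m - N ≤ i → i ≤ m + N → x.1 i = y.1 i) → (φ.1 x).1 m = (φ.1 y).1 m)
    (x : EdgeShift A) (n : ℕ) :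
    ∃ t : Finset (EdgeShift A), IsSeparated φ N n t ∧
      s ^ n * pairing w (thetaAt (ray x 0) 0).1 ≤ t.card * ∑ J, w J := by
  classical
  have hpow : ∀ x : dimGroup A, pairing w (dimAut h (φ ^ n) x).1 = s ^ n * pairing w x.1 := by
    induction n with
    | zero =>
      intro x
      obtain ⟨x, rfl⟩ := (theta h).surjective x
      rw [pow_zero, dimAut_theta, KriegerGroup.map_one, pow_zero, one_mul]
    | succ n ih =>
      intro x
      rw [pow_succ', dimAut_mul, LinearEquiv.mul_apply, hs, ih, pow_succ', mul_assoc]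
  have hU : IsBeam (ray x 0) 0 := ⟨{x}, Set.finite_singleton x, by simp⟩
  -- The range M of φ^n varies with n, but it serves only to make the image a beam. Separation uses
  -- the range N of φ, which is the same for all n.
  obtain ⟨M, hM, hM'⟩ := AutShift.exists_window₂ (φ ^ n)
  have hV : IsBeam ((φ ^ n).1 '' ray x 0) M := by simpa using hU.image_aut _ hM hM'
  obtain ⟨t, htV, htinj, hle⟩ := hw.pairing_thetaAt_le h hV
  rw [← dimAut_thetaAt h (φ ^ n) hU hV, hpow] at hle
  -- All pulled-back points lie in the ray of x. If two were not separated, `ray_pow_eq` would put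
  -- their images in one 0-ray, but t has one point per 0-ray.
  refine ⟨t.image (φ ^ n).1.symm, ?_, ?_⟩
  · intro u hu v hv huv
    obtain ⟨y, hy, rfl⟩ := Finset.mem_image.1 (Finset.mem_coe.1 hu)
    obtain ⟨z, hz, rfl⟩ := Finset.mem_image.1 (Finset.mem_coe.1 hv)
    have hmem : ∀ y ∈ t, ray ((φ ^ n).1.symm y) 0 = ray x 0 := by
      intro y hy
      obtain ⟨u, hu, rfl⟩ := htV hy
      rw [Homeomorph.symm_apply_apply]
      exact ray_eq_iff.2 hu
    have h1 := ray_pow_eq hN ((hmem y hy).trans (hmem z hz).symm) huv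
    rw [Homeomorph.apply_symm_apply, Homeomorph.apply_symm_apply] at h1
    rw [htinj hy hz h1]
  · rwa [Finset.card_image_of_injective _ (φ ^ n).1.symm.injective]

lemma PosIrreducible.nonempty (h : PosIrreducible A) : Nonempty (EdgeShift A) := by
  by_contra hne
  rw [not_nonempty_iff] at hne
  have := h.entropy_pos
  rw [topEntropy, Set.univ_eq_empty_iff.2 hne, Dynamics.coverEntropy_empty] at this
  simp at this

lemma IsPerron.exists_pos_isSeparated {l : ℝ} {w : Fin k → ℝ} (hw : IsPerron A l w)
    (h : PosIrreducible A) (φ : AutShift A) {s : ℝ}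
    (hs : ∀ x : dimGroup A, pairing w (dimAut h φ x).1 = s * pairing w x.1) :
    ∃ (N : ℕ) (c : ℝ), 0 < c ∧ ∀ n : ℕ, ∃ t : Finset (EdgeShift A),
      IsSeparated φ N n t ∧ s ^ n * c ≤ t.card := by
  obtain ⟨N, hN⟩ := AutShift.exists_window φ
  obtain ⟨x⟩ := h.nonempty
  have hS : 0 < ∑ J, w J := Finset.sum_pos (fun J _ => hw.pos J) ⟨(x.1 0).tgt, Finset.mem_univ _⟩
  -- The constant c is the weight of one 0-ray divided by ∑ w_J. It is independent of n, and
  -- positive because the ray counts itself at its end state.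
  refine ⟨N, pairing w (thetaAt (ray x 0) 0).1 / ∑ J, w J, div_pos ?_ hS, fun n => ?_⟩
  · rw [hw.pairing_thetaAt, neg_zero, zpow_zero, one_mul]
    refine Finset.sum_pos' (fun J _ => mul_nonneg (by positivity) (hw.pos J).le)
      ⟨(x.1 0).tgt, Finset.mem_univ _, mul_pos ?_ (hw.pos _)⟩
    have hU : IsBeam (ray x 0) 0 := ⟨{x}, Set.finite_singleton x, by simp⟩
    exact_mod_cast (Set.ncard_pos (endRays_finite hU _)).2 ⟨_, x, fun _ _ => rfl, rfl, rfl⟩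
  · obtain ⟨t, ht, hle⟩ := hw.exists_isSeparated h hs hN x n
    exact ⟨t, ht, by rwa [← mul_div_assoc, div_le_iff₀ hS]⟩

end SFT

/-! ### Zero entropy implies inertness -/

theorem corollary3p4 {k : ℕ} (A : Matrix (Fin k) (Fin k) ℕ)
    (hirr : (A.map (Nat.cast : ℕ → ℤ)).IsIrreducible)
    (hpos : 0 < SFT.topEntropy (SFT.shift A))
    (hdet : Irreducible
      (Matrix.det (1 - (Polynomial.X : Polynomial ℚ) • A.map (Nat.cast : ℕ → Polynomial ℚ))))
    (φ : SFT.AutShift A) (hφ : SFT.topEntropy φ.1 = 0) :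
    SFT.IsInert ⟨hirr, hpos⟩ φ := by
  classical
  have h : SFT.PosIrreducible A := ⟨hirr, hpos⟩
  have hdet' : Irreducible (SFT.ratMatrix A).charpolyRev := by
    have e : (SFT.ratMatrix A).map Polynomial.C = A.map (Nat.cast : ℕ → Polynomial ℚ) := by
      ext1 i j
      simp
    rwa [Matrix.charpolyRev, e]
  have hk : 0 < k := by
    obtain ⟨x⟩ := h.nonempty
    exact (x.1 0).src.pos
  obtain ⟨l, w, hw⟩ := h.exists_isPerron hk
  obtain ⟨s, hs0, hs⟩ := hw.exists_scale hdet' hk (SFT.dimAut_mem h φ)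
  -- The inverse automorphism scales τ by s⁻¹, so the growth argument applies to φ⁻¹ when s < 1.
  have hs' : ∀ x : SFT.dimGroup A,
      SFT.pairing w (SFT.dimAut h φ⁻¹ x).1 = s⁻¹ * SFT.pairing w x.1 := by
    intro x
    obtain ⟨y, rfl⟩ := (SFT.dimAut h φ).surjective x
    rw [hs, ← LinearEquiv.mul_apply, ← SFT.dimAut_mul, inv_mul_cancel,
      inv_mul_cancel_left₀ hs0.ne']
    obtain ⟨y, rfl⟩ := (SFT.theta h).surjective y
    rw [SFT.dimAut_theta, SFT.KriegerGroup.map_one]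
  have h1 : s ≤ 1 := by
    by_contra! hlt
    obtain ⟨N, c, hc, ht⟩ := hw.exists_pos_isSeparated h φ hs
    exact (SFT.topEntropy_pos_of_isSeparated hlt hc ht).ne' hφ
  have h2 : 1 ≤ s := by
    by_contra! hlt
    obtain ⟨N, c, hc, ht⟩ := hw.exists_pos_isSeparated h φ⁻¹ hs'
    -- The entropy hypothesis concerns φ, so the sets separated for φ⁻¹ are moved by φ^(-(n-1)) to
    -- sets of the same size separated for φ.
    refine (SFT.topEntropy_pos_of_isSeparated (φ := φ) (N := N) ((one_lt_inv₀ hs0).2 hlt) hc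
      fun n => ?_).ne' hφ
    obtain ⟨t, ht, hle⟩ := ht n
    refine ⟨t.image (φ⁻¹ ^ (n - 1)).1, ?_, ?_⟩
    · rw [Finset.coe_image]
      exact ht.image_inv
    · rwa [Finset.card_image_of_injective _ (φ⁻¹ ^ (n - 1)).1.injective]
  obtain rfl : s = 1 := le_antisymm h1 h2
  refine MonoidHom.mem_ker.2 (Subtype.ext (LinearEquiv.ext fun x => Subtype.ext ?_))
  change (SFT.dimAut h φ x).1 = x.1
  -- With s = 1 the vector S_φ x - x lies in R(A) and is killed by τ, hence is zero.
  have h3 : (SFT.dimAut h φ x).1 - x.1 ∈ SFT.eventualRange A :=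
    Submodule.sub_mem _ (SFT.dimAut h φ x).2.1 x.2.1
  refine sub_eq_zero.1 (hw.eq_zero_of_pairing_eq_zero hdet' hk h3 ?_)
  rw [map_sub, hs, one_mul, sub_self]
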